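/- Assume the Generalized Riemann Hypothesis: for every Dirichlet character $\chi$ (to any modulus), every zero of $L(s,\chi)$ in the strip $0<\Re s<1$ has real part $\frac12$. For a positive integer $q$ and reduced residues $a,b$ modulo $q$, define $$M^*(q;a,b)=\sum_{\substack{\chi \bmod q\\ \chi\neq\chi_0}}|\chi(a)-\chi(b)|^2\,\frac{L'(1,\chi^*)}{L(1,\chi^*)},$$ where $\chi$ runs over the nonprincipal Dirichlet characters modulo $q$ and $\chi^*$ is the primitive character inducing $\chi$. For a prime $p\mid q$ with $p^\nu\,\|\,q$ and a reduced residue $r$ modulo $q$, let $$e(q;p,r)=\min\{e\ge1 : p^e\equiv r^{-1}\ (\mathrm{mod}\ q/p^\nu)\},\qquad h(q;p,r)=\frac1{\phi(p^\nu)}\,\frac{\log p}{p^{e(q;p,r)}},$$ with the convention $e(q;p,r)=\infty$ and $h(q;p,r)=0$ if there is no such $e$, and let $$H(q;a,b)=\sum_{p\mid q}\bigl(h(q;p,ab^{-1})+h(q;p,ba^{-1})\bigr),$$ the sum being over the primes dividing $q$. Then there is an absolute constant $C$ such that for every positive integer $q$ and every pair $a,b$ of distinct reduced residues modulo $q$,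 if $r_1$ and $r_2$ denote the least positive residues of $ab^{-1}$ and $ba^{-1}$ modulo $q$, then $$\left|M^*(q;a,b)-\phi(q)\left(\frac{\Lambda(r_1)}{r_1}+\frac{\Lambda(r_2)}{r_2}+H(q;a,b)\right)\right|\le C\,\phi(q)\,\frac{(\log q)^2}{q},$$ where $\phi$ is Euler's totient function and $\Lambda$ is the von Mangoldt function. -/

import Mathlib

noncomputable section

/-- The Generalized Riemann Hypothesis: for every modulus `N ≥ 1` and every Dirichlet character
`χ` modulo `N`, every nontrivial zero of `L(s, χ)` (that is, every zero in the open critical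
strip `0 < Re s < 1`) has real part `1 / 2`. -/
def GRH : Prop :=
  ∀ (N : ℕ) [NeZero N] (χ : DirichletCharacter ℂ N) (s : ℂ),
    0 < s.re → s.re < 1 → χ.LFunction s = 0 → s.re = 1 / 2

/-- The logarithmic derivative `L'(1, χ*) / L(1, χ*)`, where `χ*` is the primitive character
modulo the conductor of `χ` that induces `χ`. -/
def logDerivLStarOne {q : ℕ} [NeZero q] (χ : DirichletCharacter ℂ q) : ℂ :=
  haveI : NeZero χ.conductor := ⟨χ.conductor_ne_zero⟩
  deriv χ.primitiveCharacter.LFunction 1 / χ.primitiveCharacter.LFunction 1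

open Classical in
/-- `M*(q; a, b) = ∑_{χ mod q, χ ≠ χ₀} |χ(a) - χ(b)|² L'(1, χ*) / L(1, χ*)`. -/
def Mstar (q : ℕ) [NeZero q] (a b : (ZMod q)ˣ) : ℂ :=
  ∑ χ : DirichletCharacter ℂ q with χ ≠ 1,
    ((‖χ (a : ZMod q) - χ (b : ZMod q)‖ ^ 2 : ℝ) : ℂ) * logDerivLStarOne χ

/-- The least positive integer in the residue class `x` modulo `q`. -/
def leastPosResidue {q : ℕ} (x : ZMod q) : ℕ :=
  sInf {r : ℕ | 0 < r ∧ (r : ZMod q) = x}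

/-- `e(q; p, r) = min {e ≥ 1 : p ^ e ≡ r⁻¹ mod q / p ^ ν}` with `p ^ ν ∥ q`,
equal to `⊤` if there is no such exponent. -/
def eExp (q p : ℕ) (r : (ZMod q)ˣ) : ℕ∞ :=
  sInf {x : ℕ∞ | ∃ e : ℕ, x = (e : ℕ∞) ∧ 1 ≤ e ∧
    p ^ e ≡ ((r⁻¹ : (ZMod q)ˣ) : ZMod q).val [MOD q / p ^ q.factorization p]}

/-- `h(q; p, r) = (1 / φ(p ^ ν)) (log p / p ^ e(q; p, r))` with `p ^ ν ∥ q`,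
equal to `0` if `e(q; p, r) = ∞`. -/
def hTerm (q p : ℕ) (r : (ZMod q)ˣ) : ℝ :=
  if eExp q p r = ⊤ then 0
  else 1 / (Nat.totient (p ^ q.factorization p) : ℝ) *
    (Real.log p / (p : ℝ) ^ (eExp q p r).toNat)

/-- `H(q; a, b) = ∑_{p ∣ q} (h(q; p, a b⁻¹) + h(q; p, b a⁻¹))`. -/
def HSum (q : ℕ) (a b : (ZMod q)ˣ) : ℝ :=
  ∑ p ∈ q.primeFactors, (hTerm q p (a * b⁻¹) + hTerm q p (b * a⁻¹))

end

/-! Under GRH, for nonprincipal χ the disc of centre 2 and radius 3/2 contains no zero of L(s, χ).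
There |L(s, χ)/L(2, χ)| is O(N), N being the modulus, so Borel–Carathéodory gives L'/L = O(log N) on
the disc of radius 5/4. Cutting the Taylor series of L'/L at 2 after K terms therefore costs only
O(log N · (4/5)^K) at s = 1.

The Taylor coefficients are absolutely convergent Dirichlet series, and the truncated series at 1 is
-∑ χ(n) Λ(n)/n · w(n), with w(n) the probability that a Poisson variable of mean log n is less than
K. With K = ⌈5 log q⌉ this weight is 1 up to O(n/q) and decays like n^(-1/K): no explicit formula or
prime counting is needed (`exists_norm_logDeriv_LFunction_one_add_tsum_le`).

Expanding |χ(a) - χ(b)|² and summing over χ, orthogonality picks out prime powers. If p ∤ q it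
selects a class modulo q. If p ∣ q, only characters of conductor prime to p survive, leaving a class
modulo q/p^ν with weight φ(q)/φ(p^ν) (`smoothMangoldt_mul_sum_char`). In each class the least
element gives Λ(r)/r, the least power of p gives h, and the rest is O((log q)²/q). The class of 1
enters with coefficient 2 but is itself of error size. -/

/-! ### The Poisson weight -/

/-- The probability that a Poisson variable of mean `log x` is less than `K`. -/
noncomputable def poissonWeight (K : ℕ) (x : ℝ) : ℝ :=
  x⁻¹ * ∑ k ∈ Finset.range K, Real.log x ^ k / (k.factorial : ℝ)

theorem poissonWeight_nonneg (K : ℕ) {x : ℝ} (hx : 1 ≤ x) : 0 ≤ poissonWeight K x := by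
  have := Real.log_nonneg hx
  unfold poissonWeight
  positivity

theorem poissonWeight_le_one (K : ℕ) {x : ℝ} (hx : 1 ≤ x) : poissonWeight K x ≤ 1 := by
  have hx0 : 0 < x := by linarith
  unfold poissonWeight
  rw [inv_mul_le_iff₀ hx0, mul_one]
  calc _ ≤ Real.exp (Real.log x) := Real.sum_le_exp_of_nonneg (Real.log_nonneg hx) K
    _ = x := Real.exp_log hx0

/-- Rankin's trick: for k ≥ K one has t^k = 2^(-k) (2t)^k ≤ 2^(-K) (2t)^k. -/
theorem exp_sub_sum_range_le (K : ℕ) {t : ℝ} (ht : 0 ≤ t) :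
    Real.exp t - ∑ k ∈ Finset.range K, t ^ k / (k.factorial : ℝ)
      ≤ (2 : ℝ)⁻¹ ^ K * Real.exp (2 * t) := by
  have hs : Summable fun k : ℕ => t ^ k / (k.factorial : ℝ) := Real.summable_pow_div_factorial t
  have hs2 : Summable fun k : ℕ => (2 * t) ^ k / (k.factorial : ℝ) :=
    Real.summable_pow_div_factorial _
  have he : ∀ y : ℝ, Real.exp y = ∑' k : ℕ, y ^ k / (k.factorial : ℝ) := fun y => by
    rw [Real.exp_eq_exp_ℝ, NormedSpace.exp_eq_tsum_div]
  rw [he t, he (2 * t), ← hs.sum_add_tsum_nat_add K, add_sub_cancel_left, ← tsum_mul_left]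
  refine le_trans ?_ ((hs2.mul_left ((2 : ℝ)⁻¹ ^ K)).sum_add_tsum_nat_add K).le
  refine le_trans ?_ (le_add_of_nonneg_left (Finset.sum_nonneg fun i _ => by positivity))
  refine ((summable_nat_add_iff K).2 hs).tsum_le_tsum (fun k => ?_)
    ((summable_nat_add_iff K).2 (hs2.mul_left _))
  rw [← mul_div_assoc]
  gcongr
  rw [mul_pow, ← mul_assoc, pow_add 2, mul_left_comm, ← mul_assoc]
  refine le_mul_of_one_le_left (by positivity) ?_
  rw [mul_assoc, ← mul_pow]
  norm_num
  exact one_le_pow₀ (by norm_num)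

theorem one_sub_poissonWeight_le (K : ℕ) {x : ℝ} (hx : 1 ≤ x) :
    1 - poissonWeight K x ≤ (2 : ℝ)⁻¹ ^ K * x := by
  have hx0 : 0 < x := by linarith
  have h := exp_sub_sum_range_le K (Real.log_nonneg hx)
  rw [two_mul, Real.exp_add, Real.exp_log hx0] at h
  have h2 : x * (1 - poissonWeight K x) ≤ x * ((2 : ℝ)⁻¹ ^ K * x) := by
    unfold poissonWeight
    rw [mul_sub, mul_one, mul_inv_cancel_left₀ hx0.ne']
    linarith
  exact le_of_mul_le_mul_left h2 hx0

/-- Rankin's trick with c = 1 - 1/K: since c^K ≤ c^k for k < K, the partial sum is at most c^(-K)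
x^c, and c^K ≥ 1/4. This decay makes the sum over n converge with a loss only polynomial in K. -/
theorem poissonWeight_le_rpow {K : ℕ} (hK : 2 ≤ K) {x : ℝ} (hx : 1 ≤ x) :
    poissonWeight K x ≤ 4 * x ^ (-(1 / (K : ℝ))) := by
  have hx0 : 0 < x := by linarith
  have hL := Real.log_nonneg hx
  have hK0 : (2 : ℝ) ≤ K := by exact_mod_cast hK
  set c : ℝ := 1 - 1 / (K : ℝ) with hc
  have hinv : 1 / (K : ℝ) ≤ 1 / 2 := by gcongr
  have hc0 : 0 < c := by linarith
  have hc1 : c ≤ 1 := by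
    have : 0 ≤ 1 / (K : ℝ) := by positivity
    linarith
  -- Bernoulli with exponent K would give only c^K ≥ 0, so it is applied with exponent ⌊K/2⌋ and the
  -- result is squared.
  have hcK : (1 : ℝ) / 4 ≤ c ^ K := by
    obtain ⟨j, hj | hj⟩ := Nat.even_or_odd' K
    · have hj1 : (1 : ℝ) ≤ j := by
        have : 1 ≤ j := by omega
        exact_mod_cast this
      have hb := one_add_mul_le_pow (a := -(1 / (K : ℝ))) (by linarith) j
      have : (1 : ℝ) + j * (-(1 / (K : ℝ))) = 1 / 2 := by
        rw [hj]; push_cast; field_simp; ring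
      have h2 : (1 : ℝ) / 2 ≤ c ^ j := by rw [this] at hb; rw [hc, sub_eq_add_neg]; exact hb
      have : c ^ K = c ^ j * c ^ j := by rw [hj]; ring
      rw [this]
      nlinarith
    · have hj1 : (1 : ℝ) ≤ j := by
        have : 1 ≤ j := by omega
        exact_mod_cast this
      have hb := one_add_mul_le_pow (a := -(1 / (K : ℝ))) (by linarith) j
      have hKj : (K : ℝ) = 2 * j + 1 := by rw [hj]; push_cast; ring
      have h1 : (1 : ℝ) + j * (-(1 / (K : ℝ))) = (j + 1) / (2 * j + 1) := by
        rw [hKj]; field_simp; ring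
      have h2 : ((j : ℝ) + 1) / (2 * j + 1) ≤ c ^ j := by
        rw [h1] at hb; rw [hc, sub_eq_add_neg]; exact hb
      have h3 : c ^ K = c ^ j * c ^ j * c := by rw [hj]; ring
      have h4 : c = 2 * j / (2 * j + 1) := by rw [hc, hKj]; field_simp; ring
      have h5 : ((j : ℝ) + 1) / (2 * j + 1) * (((j : ℝ) + 1) / (2 * j + 1)) * c ≤ c ^ K := by
        rw [h3]; gcongr
      refine le_trans ?_ h5
      rw [h4, div_mul_div_comm, div_mul_div_comm, div_le_div_iff₀ (by norm_num) (by positivity)]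
      nlinarith [sq_nonneg ((j : ℝ) - 1), mul_nonneg (by linarith : (0 : ℝ) ≤ j - 1) (by linarith : (0 : ℝ) ≤ j)]
  have hsum : c ^ K * ∑ k ∈ Finset.range K, Real.log x ^ k / (k.factorial : ℝ)
      ≤ Real.exp (c * Real.log x) := by
    refine le_trans ?_ (Real.sum_le_exp_of_nonneg (mul_nonneg hc0.le hL) K)
    rw [Finset.mul_sum]
    refine Finset.sum_le_sum fun k hk => ?_
    rw [← mul_div_assoc, mul_pow]
    have := pow_le_pow_of_le_one hc0.le hc1 (Finset.mem_range.1 hk).le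
    gcongr
  have hexp : Real.exp (c * Real.log x) = x * x ^ (-(1 / (K : ℝ))) := by
    rw [mul_comm, ← Real.rpow_def_of_pos hx0, hc, sub_eq_add_neg, Real.rpow_add hx0,
      Real.rpow_one]
  rw [hexp] at hsum
  unfold poissonWeight
  rw [inv_mul_le_iff₀ hx0]
  have hS : 0 ≤ ∑ k ∈ Finset.range K, Real.log x ^ k / (k.factorial : ℝ) := by positivity
  nlinarith

/-! ### Size of L(s, χ) on the disc of centre 2 and radius 3/2 -/

section LFunctionBounds

open Complex Metric

/-- Complete periods cancel, so fewer than N terms remain. -/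
theorem norm_sum_range_dirichletCharacter_le {N : ℕ} [NeZero N] {χ : DirichletCharacter ℂ N}
    (hχ : χ ≠ 1) (M : ℕ) : ‖∑ n ∈ Finset.range M, χ ((n + 1 : ℕ) : ZMod N)‖ ≤ N := by
  have hblock : ∀ c : ℕ, ∑ i ∈ Finset.range N, χ ((c + i + 1 : ℕ) : ZMod N) = 0 := fun c => by
    rw [← MulChar.sum_eq_zero_of_ne_one hχ]
    obtain ⟨n, rfl⟩ := Nat.exists_eq_succ_of_ne_zero (NeZero.ne N)
    rw [← Equiv.sum_comp (Equiv.addLeft ((c + 1 : ℕ) : ZMod (n + 1))),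
      ← Fin.sum_univ_eq_sum_range (fun i => χ ((c + i + 1 : ℕ) : ZMod (n + 1)))]
    refine Finset.sum_congr rfl fun i _ => ?_
    congr 1
    have : ((i : ℕ) : ZMod (n + 1)) = i := Fin.cast_val_eq_self i
    simp only [Equiv.coe_addLeft]
    refine Eq.trans ?_ (congrArg (((c + 1 : ℕ) : ZMod (n + 1)) + ·) this)
    push_cast
    ring
  induction M using Nat.strong_induction_on with
  | _ M ih =>
    rcases lt_or_ge M N with h | h
    · refine (norm_sum_le _ _).trans ?_
      refine (Finset.sum_le_sum fun n _ => χ.norm_le_one _).trans ?_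
      simpa using h.le
    · obtain ⟨M', rfl⟩ := Nat.exists_eq_add_of_le' h
      rw [Finset.sum_range_add, hblock, add_zero]
      exact ih _ (by have := NeZero.pos N; omega)

theorem norm_natCast_cpow_sub_le {s : ℂ} (hs : 0 < s.re) (n : ℕ) :
    ‖((n + 1 : ℕ) : ℂ) ^ (-s) - ((n + 2 : ℕ) : ℂ) ^ (-s)‖
      ≤ ‖s‖ * ((n + 1 : ℕ) : ℝ) ^ (-s.re - 1) := by
  have hd : ∀ x ∈ Set.Icc ((n + 1 : ℕ) : ℝ) ((n + 2 : ℕ) : ℝ),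
      HasDerivWithinAt (fun t : ℝ => (t : ℂ) ^ (-s)) (-s * (x : ℂ) ^ (-s - 1))
        (Set.Icc ((n + 1 : ℕ) : ℝ) ((n + 2 : ℕ) : ℝ)) x := fun x hx => by
    have hx0 : 0 < x := lt_of_lt_of_le (by positivity) hx.1
    have hs0 : -s ≠ 0 := fun h => by
      rw [neg_eq_zero] at h; simp [h] at hs
    have := hasDerivAt_ofReal_cpow_const' hx0.ne' (r := -s - 1) (by
      intro h; apply hs0; linear_combination h)
    have h2 := (this.const_mul (-s))
    simp only [sub_add_cancel] at h2
    refine HasDerivAt.hasDerivWithinAt ?_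
    refine h2.congr_of_eventuallyEq (Filter.Eventually.of_forall fun t => ?_)
    exact (mul_div_cancel₀ _ hs0).symm
  have hb : ∀ x ∈ Set.Icc ((n + 1 : ℕ) : ℝ) ((n + 2 : ℕ) : ℝ),
      ‖-s * (x : ℂ) ^ (-s - 1)‖ ≤ ‖s‖ * ((n + 1 : ℕ) : ℝ) ^ (-s.re - 1) := fun x hx => by
    have hn0 : (0 : ℝ) < ((n + 1 : ℕ) : ℝ) := by positivity
    have hx0 : 0 < x := lt_of_lt_of_le hn0 hx.1
    rw [norm_mul, norm_neg, norm_cpow_eq_rpow_re_of_pos hx0]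
    simp only [sub_re, neg_re, one_re]
    exact mul_le_mul_of_nonneg_left
      (Real.rpow_le_rpow_of_nonpos hn0 hx.1 (by linarith)) (norm_nonneg _)
  have h := (convex_Icc ((n + 1 : ℕ) : ℝ) ((n + 2 : ℕ) : ℝ)).norm_image_sub_le_of_norm_hasDerivWithin_le
    hd hb (Set.right_mem_Icc.2 (by push_cast; linarith)) (Set.left_mem_Icc.2 (by push_cast; linarith))
  have h1 : ‖((n + 1 : ℕ) : ℝ) - ((n + 2 : ℕ) : ℝ)‖ = 1 := by
    push_cast; rw [Real.norm_eq_abs]; norm_num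
  rw [h1, mul_one] at h
  simpa using h

/-- The disc is tangent to the critical line: it is the largest one about 2 that GRH keeps free of
zeros. -/
theorem re_gt_half_of_mem_ball {s : ℂ} (hs : s ∈ ball (2 : ℂ) (3 / 2)) : 1 / 2 < s.re := by
  have h := (abs_re_le_norm (s - 2)).trans_lt (mem_ball_iff_norm.1 hs)
  simp only [sub_re, re_ofNat] at h
  linarith [(abs_lt.1 h).1]

/-- The sum of `n ^ (-3 / 2)`. -/
noncomputable def zetaThreeHalves : ℝ := ∑' n : ℕ, ((n + 1 : ℕ) : ℝ) ^ (-(3 / 2) : ℝ)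

theorem summable_rpow_neg_three_halves :
    Summable fun n : ℕ => ((n + 1 : ℕ) : ℝ) ^ (-(3 / 2) : ℝ) :=
  (summable_nat_add_iff 1).2 (Real.summable_nat_rpow.2 (by norm_num))

/-- On the disc |s| < 2 + 3/2 = 7/2, and Re s > 1/2 makes the differences O(n^(-3/2)), uniformly in
s. -/
theorem norm_abel_term_le {N : ℕ} [NeZero N] {χ : DirichletCharacter ℂ N} (hχ : χ ≠ 1)
    (n : ℕ) {s : ℂ} (hs : s ∈ ball (2 : ℂ) (3 / 2)) :
    ‖(∑ k ∈ Finset.range (n + 1), χ ((k + 1 : ℕ) : ZMod N)) *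
      (((n + 1 : ℕ) : ℂ) ^ (-s) - ((n + 2 : ℕ) : ℂ) ^ (-s))‖
      ≤ (N * (7 / 2)) * ((n + 1 : ℕ) : ℝ) ^ (-(3 / 2) : ℝ) := by
  have hre := re_gt_half_of_mem_ball hs
  rw [norm_mul, mul_assoc]
  refine mul_le_mul (norm_sum_range_dirichletCharacter_le hχ _) ?_ (norm_nonneg _) (by positivity)
  refine (norm_natCast_cpow_sub_le (by linarith) n).trans ?_
  refine mul_le_mul ((norm_lt_of_mem_ball hs).le.trans (by norm_num)) ?_ (by positivity) (by norm_num)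
  exact Real.rpow_le_rpow_of_exponent_le (by push_cast; linarith [Nat.cast_nonneg (α := ℝ) n])
    (by linarith)

theorem LSeries_eq_tsum_abel {N : ℕ} [NeZero N] {χ : DirichletCharacter ℂ N} (hχ : χ ≠ 1)
    {s : ℂ} (hs : s ∈ ball (2 : ℂ) (3 / 2)) (hs1 : 1 < s.re) :
    LSeries (fun n : ℕ => χ n) s = ∑' n : ℕ, (∑ k ∈ Finset.range (n + 1), χ ((k + 1 : ℕ) : ZMod N)) *
      (((n + 1 : ℕ) : ℂ) ^ (-s) - ((n + 2 : ℕ) : ℂ) ^ (-s)) := by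
  set S : ℕ → ℂ := fun n => ∑ k ∈ Finset.range n, χ ((k + 1 : ℕ) : ZMod N) with hS
  set g : ℕ → ℂ := fun n => ((n + 1 : ℕ) : ℂ) ^ (-s) with hg
  have habel : ∀ M : ℕ, ∑ n ∈ Finset.range M, χ ((n + 1 : ℕ) : ZMod N) * g n
      = S M * g M + ∑ n ∈ Finset.range M, S (n + 1) * (g n - g (n + 1)) := fun M => by
    induction M with
    | zero => simp [hS]
    | succ M ih =>
      rw [Finset.sum_range_succ, Finset.sum_range_succ, ih]
      have : S (M + 1) = S M + χ ((M + 1 : ℕ) : ZMod N) := Finset.sum_range_succ _ _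
      rw [this]
      ring
  have hsum : Summable fun n : ℕ => S (n + 1) * (g n - g (n + 1)) :=
    Summable.of_norm_bounded (summable_rpow_neg_three_halves.mul_left (N * (7 / 2) : ℝ))
      fun n => norm_abel_term_le hχ n hs
  have hlim2 := hsum.hasSum.tendsto_sum_nat
  have hzero : Filter.Tendsto (fun M => S M * g M) Filter.atTop (nhds 0) := by
    refine squeeze_zero_norm (a := fun M : ℕ => (N : ℝ) * ((M + 1 : ℕ) : ℝ) ^ (-s.re)) (fun M => ?_) ?_
    · rw [norm_mul]
      refine mul_le_mul (norm_sum_range_dirichletCharacter_le hχ M) (le_of_eq ?_)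
        (norm_nonneg _) (by positivity)
      rw [hg]
      have := norm_natCast_cpow_of_pos (Nat.succ_pos M) (-s)
      simpa using this
    · have h1 := (tendsto_rpow_neg_atTop (y := s.re) (by linarith)).comp
        (tendsto_natCast_atTop_atTop.comp (Filter.tendsto_add_atTop_nat 1))
      simpa [Function.comp_def] using h1.const_mul (N : ℝ)
  have hL : HasSum (fun n : ℕ => χ ((n + 1 : ℕ) : ZMod N) * g n) (LSeries (fun n : ℕ => χ n) s) := by
    have h := (χ.LSeriesSummable_of_one_lt_re hs1).LSeriesHasSum
    unfold LSeriesHasSum at h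
    rw [← hasSum_nat_add_iff' 1] at h
    simp only [Finset.range_one, Finset.sum_singleton, LSeries.term_zero, sub_zero] at h
    refine h.congr_fun fun n => ?_
    rw [LSeries.term_of_ne_zero (Nat.succ_ne_zero n), div_eq_mul_inv, ← cpow_neg]
  have hlim1 := hL.tendsto_sum_nat
  simp_rw [habel] at hlim1
  have := tendsto_nhds_unique hlim1 (hzero.add hlim2)
  rw [this, zero_add]

/-- The summed-by-parts series is holomorphic on the whole disc and equals L near 2, so the identity
theorem applies. -/
theorem LFunction_eq_tsum_abel {N : ℕ} [NeZero N] {χ : DirichletCharacter ℂ N} (hχ : χ ≠ 1)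
    {s : ℂ} (hs : s ∈ ball (2 : ℂ) (3 / 2)) :
    χ.LFunction s = ∑' n : ℕ, (∑ k ∈ Finset.range (n + 1), χ ((k + 1 : ℕ) : ZMod N)) *
      (((n + 1 : ℕ) : ℂ) ^ (-s) - ((n + 2 : ℕ) : ℂ) ^ (-s)) := by
  have hd : DifferentiableOn ℂ (fun s : ℂ => ∑' n : ℕ,
      (∑ k ∈ Finset.range (n + 1), χ ((k + 1 : ℕ) : ZMod N)) *
        (((n + 1 : ℕ) : ℂ) ^ (-s) - ((n + 2 : ℕ) : ℂ) ^ (-s))) (ball (2 : ℂ) (3 / 2)) := by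
    refine differentiableOn_tsum_of_summable_norm
      (summable_rpow_neg_three_halves.mul_left (N * (7 / 2) : ℝ)) (fun n => ?_) isOpen_ball
      (fun n w hw => norm_abel_term_le hχ n hw)
    have h : ∀ m : ℕ, Differentiable ℂ fun s : ℂ => ((m + 1 : ℕ) : ℂ) ^ (-s) := fun m =>
      differentiable_neg.const_cpow (Or.inl (Nat.cast_ne_zero.2 (Nat.succ_ne_zero m)))
    exact (((h n).sub (h (n + 1))).const_mul _).differentiableOn
  refine (AnalyticOnNhd.eqOn_of_preconnected_of_eventuallyEq
    ((DirichletCharacter.differentiable_LFunction hχ).differentiableOn.analyticOnNhd isOpen_ball)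
    (hd.analyticOnNhd isOpen_ball) (convex_ball _ _).isPreconnected
    (mem_ball_self (by norm_num) : (2 : ℂ) ∈ _) ?_) hs
  have h1 : {z : ℂ | 1 < z.re} ∈ nhds (2 : ℂ) :=
    (isOpen_lt continuous_const continuous_re).mem_nhds (by simp)
  filter_upwards [h1, isOpen_ball.mem_nhds (mem_ball_self (x := (2 : ℂ)) (ε := 3 / 2) (by norm_num))]
    with z hz hz2
  rw [DirichletCharacter.LFunction_eq_LSeries χ hz, LSeries_eq_tsum_abel hχ hz2 hz]

theorem norm_LFunction_le_of_mem_ball {N : ℕ} [NeZero N] {χ : DirichletCharacter ℂ N} (hχ : χ ≠ 1)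
    {s : ℂ} (hs : s ∈ ball (2 : ℂ) (3 / 2)) :
    ‖χ.LFunction s‖ ≤ N * (7 / 2) * zetaThreeHalves := by
  rw [LFunction_eq_tsum_abel hχ hs, zetaThreeHalves, ← tsum_mul_left]
  exact tsum_of_norm_bounded (summable_rpow_neg_three_halves.mul_left (N * (7 / 2) : ℝ)).hasSum
    fun n => norm_abel_term_le hχ n hs

/-- 1/L(2, χ) = ∑ μ(n) χ(n) n^(-2), majorised crudely by ∑ n^(-3/2) so that one constant serves
throughout. -/
theorem one_le_norm_LFunction_two_mul {N : ℕ} [NeZero N] (χ : DirichletCharacter ℂ N) :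
    1 ≤ ‖χ.LFunction 2‖ * zetaThreeHalves := by
  have h2 : (1 : ℝ) < (2 : ℂ).re := by simp
  have h := DirichletCharacter.LSeries.mul_mu_eq_one χ h2
  rw [← DirichletCharacter.LFunction_eq_LSeries χ h2] at h
  have h' := congrArg norm h
  rw [norm_mul, norm_one] at h'
  rw [← h']
  refine mul_le_mul_of_nonneg_left ?_ (norm_nonneg _)
  set f : ℕ → ℂ := (fun n : ℕ => χ n) * fun n : ℕ => (ArithmeticFunction.moebius n : ℂ) with hf
  have hs3 : Summable fun n : ℕ => (n : ℝ) ^ (-(3 / 2) : ℝ) :=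
    Real.summable_nat_rpow.2 (by norm_num)
  have hz : zetaThreeHalves = ∑' n : ℕ, (n : ℝ) ^ (-(3 / 2) : ℝ) := by
    rw [hs3.tsum_eq_zero_add, zetaThreeHalves]
    simp [Real.zero_rpow]
  rw [hz]
  refine tsum_of_norm_bounded hs3.hasSum fun n => ?_
  rcases eq_or_ne n 0 with rfl | hn
  · simp [Real.zero_rpow]
  rw [LSeries.term_of_ne_zero hn, norm_div, norm_natCast_cpow_of_pos (Nat.pos_of_ne_zero hn),
    Real.rpow_neg (by positivity), div_eq_mul_inv]
  have h1 : (1 : ℝ) ≤ n := by exact_mod_cast Nat.pos_of_ne_zero hn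
  have hfn : ‖f n‖ ≤ 1 := by
    simp only [hf, Pi.mul_apply, norm_mul]
    refine mul_le_one₀ (χ.norm_le_one _) (norm_nonneg _) ?_
    rw [Complex.norm_intCast]
    exact_mod_cast ArithmeticFunction.abs_moebius_le_one
  calc _ ≤ 1 * ((n : ℝ) ^ (2 : ℂ).re)⁻¹ := by gcongr
    _ ≤ _ := by
      rw [one_mul]
      gcongr
      norm_num

/-! ### Logarithmic derivatives and Taylor truncation -/

/-- Borel–Carathéodory for the logarithmic derivative of a zero-free function. -/
theorem norm_deriv_div_le_of_ne_zero {F : ℂ → ℂ} {c : ℂ} {M : ℝ} (hM : 0 < M)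
    (hF : DifferentiableOn ℂ F (ball c (3 / 2))) (hF0 : ∀ z ∈ ball c (3 / 2), F z ≠ 0)
    (hb : ∀ z ∈ ball c (3 / 2), ‖F z‖ ≤ Real.exp M * ‖F c‖) {s : ℂ}
    (hs : s ∈ closedBall c (5 / 4)) : ‖deriv F s / F s‖ ≤ 184 * M := by
  have hcm : c ∈ ball c (3 / 2 : ℝ) := mem_ball_self (by norm_num)
  have hd : DifferentiableOn ℂ (fun z => deriv F z / F z) (ball c (3 / 2)) :=
    (hF.deriv isOpen_ball).div hF hF0
  -- A primitive of F'/F normalised to vanish at c is a branch of log(F/F(c)), whose real part is at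
  -- most M.
  obtain ⟨G₀, hG₀⟩ := hd.isExactOn_ball
  set G : ℂ → ℂ := fun z => G₀ z - G₀ c with hGdef
  have hG : ∀ z ∈ ball c (3 / 2 : ℝ), HasDerivAt G (deriv F z / F z) z := fun z hz =>
    (hG₀ z hz).sub_const _
  have hGd : DifferentiableOn ℂ G (ball c (3 / 2)) := fun z hz =>
    (hG z hz).differentiableAt.differentiableWithinAt
  have hGc : G c = 0 := sub_self _
  have hconst : ∀ z ∈ ball c (3 / 2 : ℝ), F z * exp (-G z) = F c := fun z hz => by
    have hder : ∀ w ∈ ball c (3 / 2 : ℝ), HasDerivAt (fun w => F w * exp (-G w)) 0 w := fun w hw => by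
      have h1 := ((hF w hw).differentiableAt (isOpen_ball.mem_nhds hw)).hasDerivAt
      refine (h1.mul (hG w hw).fun_neg.cexp).congr_deriv ?_
      have := hF0 w hw
      field_simp
      ring
    have := (convex_ball c (3 / 2 : ℝ)).is_const_of_fderivWithin_eq_zero (𝕜 := ℂ)
      (f := fun w => F w * exp (-G w))
      (fun w hw => (hder w hw).differentiableAt.differentiableWithinAt)
      (fun w hw => by
        rw [fderivWithin_of_isOpen isOpen_ball hw]
        ext
        simpa using (hder w hw).deriv) hz hcm
    simpa [hGc] using this
  have hre : ∀ z ∈ ball c (3 / 2 : ℝ), (G z).re ≤ M := fun z hz => by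
    have h1 : ‖F z‖ = ‖F c‖ * Real.exp (G z).re := by
      rw [← norm_exp, ← norm_mul, ← hconst z hz, mul_assoc, ← exp_add]
      simp
    have h2 := hb z hz
    rw [h1, mul_comm] at h2
    exact Real.exp_le_exp.1 (le_of_mul_le_mul_right h2 (norm_pos_iff.2 (hF0 c hcm)))
  have hmaps : Set.MapsTo (fun z : ℂ => c + z) (ball 0 (3 / 2)) (ball c (3 / 2)) := fun z hz => by
    simpa using hz
  have hBC : ∀ w ∈ closedBall c (11 / 8 : ℝ), ‖G w‖ ≤ 23 * M := fun w hw => by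
    have hw' : ‖w - c‖ ≤ 11 / 8 := mem_closedBall_iff_norm.1 hw
    have h := borelCaratheodory_zero (f := fun z => G (c + z)) (z := w - c) hM
      (hGd.comp (by fun_prop) hmaps)
      (fun z hz => hre _ (hmaps hz)) (by norm_num)
      (by rw [mem_ball_zero_iff]; linarith) (by simpa using hGc)
    simp only [add_sub_cancel] at h
    refine h.trans ?_
    rw [div_le_iff₀ (by linarith)]
    nlinarith
  have hs' : ‖s - c‖ ≤ 5 / 4 := mem_closedBall_iff_norm.1 hs
  have hsub : closedBall s (1 / 8 : ℝ) ⊆ closedBall c (11 / 8) := fun w hw => by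
    have := mem_closedBall_iff_norm.1 hw
    rw [mem_closedBall_iff_norm]
    calc ‖w - c‖ = ‖(w - s) + (s - c)‖ := by ring_nf
      _ ≤ _ := norm_add_le _ _
      _ ≤ _ := by linarith
  have hsub2 : closedBall c (11 / 8 : ℝ) ⊆ ball c (3 / 2) := closedBall_subset_ball (by norm_num)
  have hsb : s ∈ ball c (3 / 2 : ℝ) := closedBall_subset_ball (by norm_num) hs
  -- Cauchy's estimate on a circle of radius 1/8 turns the bound 23M for G into 8 · 23M = 184M.
  have h := norm_deriv_le_of_forall_mem_sphere_norm_le (f := G) (c := s) (R := 1 / 8)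
    (C := 23 * M) (by norm_num)
    ((hGd.mono (hsub.trans hsub2)).diffContOnCl_ball subset_rfl)
    (fun z hz => hBC z (hsub (sphere_subset_closedBall hz)))
  rw [(hG s hsb).deriv] at h
  refine h.trans (le_of_eq ?_)
  ring

/-- The remainder of a truncated Taylor series at distance `1` from the centre. -/
theorem norm_sub_taylor_le {f : ℂ → ℂ} {c z : ℂ} {R C : ℝ} (hR : 5 / 4 < R)
    (hf : DifferentiableOn ℂ f (ball c R)) (hC : ∀ w ∈ closedBall c (5 / 4), ‖f w‖ ≤ C)
    (hz : ‖z - c‖ = 1) (K : ℕ) :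
    ‖f z - ∑ k ∈ Finset.range K, (k.factorial : ℂ)⁻¹ * (z - c) ^ k * iteratedDeriv k f c‖
      ≤ 5 * C * (4 / 5) ^ K := by
  have hz' : z ∈ ball c R := by rw [mem_ball_iff_norm, hz]; linarith
  have hsum := hasSum_taylorSeries_on_ball hf hz'
  -- Cauchy's estimate on the circle of radius 5/4, evaluated at distance 1, gives the ratio 4/5;
  -- the geometric tail supplies the factor 5.
  have hcoef : ∀ k : ℕ, ‖(k.factorial : ℂ)⁻¹ • (z - c) ^ k • iteratedDeriv k f c‖
      ≤ C * (4 / 5) ^ k := fun k => by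
    have h := norm_iteratedDeriv_le_of_forall_mem_sphere_norm_le k (by norm_num : (0 : ℝ) < 5 / 4)
      ((hf.mono (closedBall_subset_ball hR)).diffContOnCl_ball subset_rfl)
      (fun w hw => hC w (sphere_subset_closedBall hw))
    rw [norm_smul, norm_smul, norm_pow, hz, one_pow, one_mul, norm_inv, norm_natCast,
      inv_mul_le_iff₀ (by positivity)]
    refine h.trans (le_of_eq ?_)
    rw [mul_div_assoc, div_eq_mul_inv C, ← inv_pow]
    norm_num
  have ht := (hasSum_nat_add_iff' K).2 hsum
  have hg : HasSum (fun k : ℕ => C * (4 / 5 : ℝ) ^ (k + K)) (5 * C * (4 / 5) ^ K) := by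
    have := (hasSum_geometric_of_lt_one (r := 4 / 5) (by norm_num) (by norm_num)).mul_left
      (C * (4 / 5 : ℝ) ^ K)
    have h5 : C * (4 / 5 : ℝ) ^ K * (1 - 4 / 5)⁻¹ = 5 * C * (4 / 5) ^ K := by norm_num; ring
    rw [h5] at this
    exact this.congr_fun fun k => by ring
  have := tsum_of_norm_bounded hg fun k => hcoef (k + K)
  rw [ht.tsum_eq] at this
  simpa only [smul_eq_mul, mul_assoc] using this

/-! ### Approximating L'/L at 1 under GRH -/

theorem LFunction_ne_zero_of_mem_ball (hGRH : GRH) {N : ℕ} [NeZero N] {χ : DirichletCharacter ℂ N}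
    (hχ : χ ≠ 1) {s : ℂ} (hs : s ∈ ball (2 : ℂ) (3 / 2)) : χ.LFunction s ≠ 0 := fun h0 => by
  have hre := re_gt_half_of_mem_ball hs
  rcases lt_or_ge s.re 1 with h | h
  · linarith [hGRH N χ s (by linarith) h h0]
  · exact DirichletCharacter.LFunction_ne_zero_of_one_le_re χ (Or.inl hχ) h h0

theorem three_le_of_dirichletCharacter_ne_one {N : ℕ} [NeZero N] {χ : DirichletCharacter ℂ N}
    (hχ : χ ≠ 1) : 3 ≤ N := by
  by_contra h
  have h0 := NeZero.ne N
  have hN : N = 1 ∨ N = 2 := by omega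
  rcases hN with rfl | rfl
  · exact hχ (DirichletCharacter.level_one χ)
  · refine hχ (MulChar.ext fun u => ?_)
    rw [Subsingleton.elim u 1]
    simp

theorem one_lt_log_of_three_le {q : ℕ} (hq : 3 ≤ q) : 1 < Real.log q := by
  rw [Real.lt_log_iff_exp_lt (by positivity)]
  have : (3 : ℝ) ≤ q := by exact_mod_cast hq
  linarith [Real.exp_one_lt_three]

theorem exists_norm_logDeriv_LFunction_le (hGRH : GRH) :
    ∃ C : ℝ, 0 < C ∧ ∀ (N : ℕ) [NeZero N] (χ : DirichletCharacter ℂ N), χ ≠ 1 →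
      ∀ s ∈ closedBall (2 : ℂ) (5 / 4),
        ‖deriv χ.LFunction s / χ.LFunction s‖ ≤ C * Real.log N := by
  have hZ : 0 < zetaThreeHalves :=
    summable_rpow_neg_three_halves.tsum_pos (fun n => by positivity) 0 (by simp)
  set B : ℝ := 7 / 2 * zetaThreeHalves * zetaThreeHalves with hB
  have hB0 : 0 < B := by positivity
  refine ⟨184 * (|Real.log B| + 1), by positivity, fun N _ χ hχ s hs => ?_⟩
  have hN := one_lt_log_of_three_le (three_le_of_dirichletCharacter_ne_one hχ)
  have hN0 : (0 : ℝ) < N := Nat.cast_pos.2 (NeZero.pos N)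
  rw [mul_assoc]
  refine norm_deriv_div_le_of_ne_zero (by positivity)
    (DirichletCharacter.differentiable_LFunction hχ).differentiableOn
    (fun z hz => LFunction_ne_zero_of_mem_ball hGRH hχ hz) (fun z hz => ?_) hs
  have h1 := norm_LFunction_le_of_mem_ball hχ hz
  have h2 := one_le_norm_LFunction_two_mul χ
  -- Since log N > 1, the constant log B is absorbed into a multiple of log N.
  have h3 : B * N ≤ Real.exp ((|Real.log B| + 1) * Real.log N) := by
    rw [← Real.log_le_iff_le_exp (by positivity), Real.log_mul hB0.ne' hN0.ne']
    nlinarith [le_abs_self (Real.log B), abs_nonneg (Real.log B)]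
  calc ‖χ.LFunction z‖ ≤ N * (7 / 2) * zetaThreeHalves * 1 := by rwa [mul_one]
    _ ≤ N * (7 / 2) * zetaThreeHalves * (‖χ.LFunction 2‖ * zetaThreeHalves) := by gcongr
    _ = B * N * ‖χ.LFunction 2‖ := by rw [hB]; ring
    _ ≤ _ := by gcongr

theorem iterate_logMul_apply (f : ℕ → ℂ) (k n : ℕ) :
    (LSeries.logMul^[k] f) n = (log n) ^ k * f n := by
  induction k with
  | zero => simp
  | succ k ih =>
    rw [Function.iterate_succ_apply', LSeries.logMul, ih]
    ring

theorem term_logMul_div_factorial {N : ℕ} (χ : DirichletCharacter ℂ N) (k n : ℕ) :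
    (k.factorial : ℂ)⁻¹ * LSeries.term (LSeries.logMul^[k]
      ((fun n : ℕ => χ n) * fun n : ℕ => (ArithmeticFunction.vonMangoldt n : ℂ))) 2 n
      = χ n * ((ArithmeticFunction.vonMangoldt n / n *
        ((n : ℝ)⁻¹ * (Real.log n ^ k / (k.factorial : ℝ))) : ℝ) : ℂ) := by
  rcases eq_or_ne n 0 with rfl | hn
  · simp
  rw [LSeries.term_of_ne_zero hn, iterate_logMul_apply]
  have : log (n : ℂ) = ((Real.log n : ℝ) : ℂ) := by
    rw [ofReal_log (Nat.cast_nonneg n), ofReal_natCast]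
  rw [this, Pi.mul_apply]
  push_cast
  have hn' : (n : ℂ) ≠ 0 := Nat.cast_ne_zero.2 hn
  have h2 : (n : ℂ) ^ (2 : ℂ) = n * n := by rw [cpow_ofNat]; ring
  rw [h2]
  field_simp

theorem abscissaOfAbsConv_twist_vonMangoldt_lt {N : ℕ} (χ : DirichletCharacter ℂ N) {s : ℂ}
    (hs : 1 < s.re) : LSeries.abscissaOfAbsConv
      ((fun n : ℕ => χ n) * fun n : ℕ => (ArithmeticFunction.vonMangoldt n : ℂ)) < s.re := by
  refine lt_of_le_of_lt (b := ((1 : ℝ) : EReal)) ?_ (EReal.coe_lt_coe_iff.2 hs)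
  refine LSeries.abscissaOfAbsConv_le_of_forall_lt_LSeriesSummable fun y hy => ?_
  exact χ.LSeriesSummable_twist_vonMangoldt (by simpa using hy)

theorem summable_twist_term {N : ℕ} (χ : DirichletCharacter ℂ N) (k : ℕ) :
    Summable fun n : ℕ => χ n * ((ArithmeticFunction.vonMangoldt n / n *
        ((n : ℝ)⁻¹ * (Real.log n ^ k / (k.factorial : ℝ))) : ℝ) : ℂ) := by
  have h : LSeriesSummable (LSeries.logMul^[k]
      ((fun n : ℕ => χ n) * fun n : ℕ => (ArithmeticFunction.vonMangoldt n : ℂ))) 2 := by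
    refine LSeriesSummable_of_abscissaOfAbsConv_lt_re ?_
    rw [LSeries.absicssaOfAbsConv_logPowMul]
    exact abscissaOfAbsConv_twist_vonMangoldt_lt χ (by simp)
  simp_rw [← term_logMul_div_factorial]
  exact h.mul_left _

/-- The sign (1 - 2)^k cancels the (-1)^k from differentiating n^(-s), so all the weights are
nonnegative. -/
theorem iteratedDeriv_logDeriv_LFunction_two {N : ℕ} [NeZero N] (χ : DirichletCharacter ℂ N) (k : ℕ) :
    (k.factorial : ℂ)⁻¹ * (1 - 2) ^ k *
        iteratedDeriv k (fun s => deriv χ.LFunction s / χ.LFunction s) 2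
      = -∑' n : ℕ, χ n * ((ArithmeticFunction.vonMangoldt n / n *
        ((n : ℝ)⁻¹ * (Real.log n ^ k / (k.factorial : ℝ))) : ℝ) : ℂ) := by
  have he : (fun s => deriv χ.LFunction s / χ.LFunction s) =ᶠ[nhds 2]
      -LSeries ((fun n : ℕ => χ n) * fun n : ℕ => (ArithmeticFunction.vonMangoldt n : ℂ)) := by
    have h1 : {z : ℂ | 1 < z.re} ∈ nhds (2 : ℂ) :=
      (isOpen_lt continuous_const continuous_re).mem_nhds (by simp)
    filter_upwards [h1] with z hz
    rw [Pi.neg_apply, χ.LSeries_twist_vonMangoldt_eq hz, χ.LFunction_eq_LSeries hz,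
      χ.deriv_LFunction_eq_deriv_LSeries hz, neg_div, neg_neg]
  rw [he.iteratedDeriv_eq, iteratedDeriv_neg,
    LSeries_iteratedDeriv k (abscissaOfAbsConv_twist_vonMangoldt_lt χ (by simp)), LSeries]
  simp_rw [← term_logMul_div_factorial]
  rw [tsum_mul_left]
  have : ((1 : ℂ) - 2) ^ k * (-1) ^ k = 1 := by rw [← mul_pow]; norm_num
  linear_combination (-(k.factorial : ℂ)⁻¹ * ∑' n, LSeries.term (LSeries.logMul^[k]
      ((fun n : ℕ => χ n) * fun n : ℕ => (ArithmeticFunction.vonMangoldt n : ℂ))) 2 n) * this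

theorem vonMangoldt_mul_poissonWeight (K n : ℕ) :
    ArithmeticFunction.vonMangoldt n / n * poissonWeight K n
      = ∑ k ∈ Finset.range K, ArithmeticFunction.vonMangoldt n / n *
        ((n : ℝ)⁻¹ * (Real.log n ^ k / (k.factorial : ℝ))) := by
  rw [poissonWeight, Finset.mul_sum, Finset.mul_sum]

theorem summable_twist_poissonWeight {N : ℕ} (χ : DirichletCharacter ℂ N) (K : ℕ) :
    Summable fun n : ℕ => χ n *
      ((ArithmeticFunction.vonMangoldt n / n * poissonWeight K n : ℝ) : ℂ) := by
  simp_rw [vonMangoldt_mul_poissonWeight, ofReal_sum, Finset.mul_sum]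
  exact summable_sum fun k _ => summable_twist_term χ k

/-- Under GRH, `L'(1, χ) / L(1, χ)` is approximated by a smoothed sum over prime powers. -/
theorem exists_norm_logDeriv_LFunction_one_add_tsum_le (hGRH : GRH) :
    ∃ C : ℝ, 0 < C ∧ ∀ (N : ℕ) [NeZero N] (χ : DirichletCharacter ℂ N), χ ≠ 1 → ∀ K : ℕ,
      ‖deriv χ.LFunction 1 / χ.LFunction 1 + ∑' n : ℕ, χ n *
        ((ArithmeticFunction.vonMangoldt n / n * poissonWeight K n : ℝ) : ℂ)‖
        ≤ C * Real.log N * (4 / 5) ^ K := by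
  obtain ⟨C, hC0, hC⟩ := exists_norm_logDeriv_LFunction_le hGRH
  refine ⟨5 * C, by positivity, fun N _ χ hχ K => ?_⟩
  have hLd := DirichletCharacter.differentiable_LFunction hχ
  have hd : DifferentiableOn ℂ (fun s => deriv χ.LFunction s / χ.LFunction s) (ball 2 (3 / 2)) :=
    (hLd.differentiableOn.deriv isOpen_ball).div hLd.differentiableOn
      fun z hz => LFunction_ne_zero_of_mem_ball hGRH hχ hz
  have h := norm_sub_taylor_le (z := 1) (by norm_num) hd (hC N χ hχ) (by norm_num) K
  simp_rw [iteratedDeriv_logDeriv_LFunction_two] at h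
  rw [Finset.sum_neg_distrib, sub_neg_eq_add,
    ← Summable.tsum_finsetSum fun k _ => summable_twist_term χ k] at h
  simp_rw [vonMangoldt_mul_poissonWeight, ofReal_sum, Finset.mul_sum]
  rw [mul_assoc 5 C]
  simpa only [mul_assoc] using h

end LFunctionBounds

/-! ### Orthogonality for primitive characters -/

/-- Here m is the largest divisor of q prime to n. If χ*(n) ≠ 0, the conductor is prime to n, hence
divides m, so χ is induced from level m; orthogonality modulo m finishes. -/
theorem sum_inv_mul_primitiveCharacter {q m n : ℕ} [NeZero q] (hm : m ∣ q) (hn : n.Coprime m)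
    (hmax : ∀ c, c ∣ q → n.Coprime c → c ∣ m) (u : (ZMod q)ˣ) :
    ∑ χ : DirichletCharacter ℂ q,
        χ ((u⁻¹ : (ZMod q)ˣ) : ZMod q) * χ.primitiveCharacter (n : ZMod χ.conductor)
      = if n ≡ (u : ZMod q).val [MOD m] then (m.totient : ℂ) else 0 := by
  have : NeZero m := ⟨fun h => NeZero.ne q (Nat.eq_zero_of_zero_dvd (h ▸ hm))⟩
  have key : ∑ ψ : DirichletCharacter ℂ m,
        ψ ((ZMod.castHom hm (ZMod m) u)⁻¹) * ψ (n : ZMod m)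
      = ∑ χ : DirichletCharacter ℂ q,
        χ ((u⁻¹ : (ZMod q)ˣ) : ZMod q) * χ.primitiveCharacter (n : ZMod χ.conductor) := by
    refine Finset.sum_of_injOn (DirichletCharacter.changeLevel hm)
      ((DirichletCharacter.changeLevel_injective hm).injOn) (fun _ _ => Finset.mem_coe.2 (Finset.mem_univ _)) ?_ ?_
    · intro χ _ hχ
      by_contra h0
      have h1 : χ.primitiveCharacter (n : ZMod χ.conductor) ≠ 0 := right_ne_zero_of_mul h0
      have h2 : n.Coprime χ.conductor := by
        rw [← ZMod.isUnit_iff_coprime]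
        by_contra h
        exact h1 (MulChar.map_nonunit _ h)
      have h3 := (χ.mem_conductorSet_iff_conductor_dvd hm).2
        (hmax _ χ.conductor_dvd_level h2)
      obtain ⟨_, ψ, hψ⟩ := h3
      exact hχ ⟨ψ, Finset.mem_coe.2 (Finset.mem_univ _), hψ.symm⟩
    · intro ψ _
      rw [DirichletCharacter.changeLevel_eq_cast_of_dvd]
      have h1 := DirichletCharacter.primitiveCharacter_changeLevel_apply hm ψ (n : ℤ)
      have h2 := ψ.primitiveCharacter_apply_of_isCoprime (a := (n : ℤ))
        (Nat.isCoprime_iff_coprime.2 hn)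
      rw [Int.cast_natCast, Int.cast_natCast] at h1
      rw [Int.cast_natCast, Int.cast_natCast] at h2
      rw [h1, h2]
      congr 2
      refine ZMod.inv_eq_of_mul_eq_one _ _ _ ?_
      rw [← ZMod.castHom_apply (h := hm), ← map_mul, Units.mul_inv, map_one]
  rw [← key, DirichletCharacter.sum_char_inv_mul_char_eq ℂ (u.isUnit.map _)]
  have hval : ZMod.castHom hm (ZMod m) u = (((u : ZMod q).val : ℕ) : ZMod m) := by
    rw [ZMod.castHom_apply, ZMod.cast_eq_val]
  simp only [hval, ← ZMod.natCast_eq_natCast_iff]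
  simp only [eq_comm]

theorem norm_sub_sq_dirichletCharacter {q : ℕ} [NeZero q] (χ : DirichletCharacter ℂ q)
    (a b : (ZMod q)ˣ) :
    ((‖χ (a : ZMod q) - χ (b : ZMod q)‖ ^ 2 : ℝ) : ℂ)
      = 2 * χ ((1⁻¹ : (ZMod q)ˣ) : ZMod q) - χ (((a * b⁻¹)⁻¹ : (ZMod q)ˣ) : ZMod q)
        - χ (((b * a⁻¹)⁻¹ : (ZMod q)ˣ) : ZMod q) := by
  have hu : ∀ c : (ZMod q)ˣ, (starRingEnd ℂ) (χ (c : ZMod q)) = χ ((c⁻¹ : (ZMod q)ˣ) : ZMod q) :=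
    fun c => by
      have h1 : χ (c : ZMod q) * χ ((c⁻¹ : (ZMod q)ˣ) : ZMod q) = 1 := by
        rw [← map_mul, Units.mul_inv, map_one]
      rw [← Complex.inv_eq_conj (χ.unit_norm_eq_one c)]
      exact inv_eq_of_mul_eq_one_right h1
  have h1 : ∀ c : (ZMod q)ˣ, χ (c : ZMod q) * χ ((c⁻¹ : (ZMod q)ˣ) : ZMod q) = 1 := fun c => by
    rw [← map_mul, Units.mul_inv, map_one]
  have h2 := Complex.mul_conj' (χ (a : ZMod q) - χ (b : ZMod q))
  rw [map_sub, hu, hu] at h2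
  push_cast
  rw [← h2]
  simp only [mul_inv, inv_inv, inv_one, Units.val_one, map_one, Units.val_mul, map_mul]
  linear_combination h1 a + h1 b

theorem norm_sub_sq_le_four {q : ℕ} [NeZero q] (χ : DirichletCharacter ℂ q)
    (a b : (ZMod q)ˣ) : ‖χ (a : ZMod q) - χ (b : ZMod q)‖ ^ 2 ≤ 4 := by
  have h := norm_sub_le (χ (a : ZMod q)) (χ (b : ZMod q))
  have h1 := χ.norm_le_one (a : ZMod q)
  have h2 := χ.norm_le_one (b : ZMod q)
  nlinarith [norm_nonneg (χ (a : ZMod q) - χ (b : ZMod q))]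

/-! ### Smoothed sums over a residue class modulo q -/

open ArithmeticFunction (vonMangoldt vonMangoldt_nonneg vonMangoldt_le_log vonMangoldt_apply_pow
  vonMangoldt_apply_prime vonMangoldt_apply_one)

/-- The summand `Λ(n) / n` smoothed by the Poisson weight. -/
noncomputable def smoothMangoldt (K n : ℕ) : ℝ := vonMangoldt n / n * poissonWeight K n

theorem one_le_cast_of_ne_zero {n : ℕ} (hn : n ≠ 0) : (1 : ℝ) ≤ n := by
  exact_mod_cast Nat.one_le_iff_ne_zero.2 hn

theorem smoothMangoldt_nonneg (K n : ℕ) : 0 ≤ smoothMangoldt K n := by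
  rcases eq_or_ne n 0 with rfl | hn
  · simp [smoothMangoldt]
  · exact mul_nonneg (div_nonneg vonMangoldt_nonneg (Nat.cast_nonneg n))
      (poissonWeight_nonneg K (one_le_cast_of_ne_zero hn))

theorem smoothMangoldt_le (K n : ℕ) : smoothMangoldt K n ≤ vonMangoldt n / n := by
  rcases eq_or_ne n 0 with rfl | hn
  · simp [smoothMangoldt]
  · exact mul_le_of_le_one_right (div_nonneg vonMangoldt_nonneg (Nat.cast_nonneg n))
      (poissonWeight_le_one K (one_le_cast_of_ne_zero hn))

theorem abs_smoothMangoldt_sub_le (K n : ℕ) :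
    |smoothMangoldt K n - vonMangoldt n / n| ≤ vonMangoldt n * (2 : ℝ)⁻¹ ^ K := by
  rcases eq_or_ne n 0 with rfl | hn
  · simp [smoothMangoldt]
  have hn1 := one_le_cast_of_ne_zero hn
  rw [abs_sub_comm, abs_of_nonneg (sub_nonneg.2 (smoothMangoldt_le K n))]
  calc vonMangoldt n / n - smoothMangoldt K n
      = vonMangoldt n / n * (1 - poissonWeight K n) := by rw [smoothMangoldt]; ring
    _ ≤ vonMangoldt n / n * ((2 : ℝ)⁻¹ ^ K * n) :=
        mul_le_mul_of_nonneg_left (one_sub_poissonWeight_le K hn1)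
          (div_nonneg vonMangoldt_nonneg (Nat.cast_nonneg n))
    _ = _ := by field_simp

theorem summable_smoothMangoldt (K : ℕ) : Summable (smoothMangoldt K) := by
  have h := summable_twist_poissonWeight (1 : DirichletCharacter ℂ 1) K
  rw [← Complex.summable_ofReal]
  refine h.congr fun n => ?_
  rw [Subsingleton.elim (n : ZMod 1) 1, map_one, one_mul, smoothMangoldt]

theorem summable_ite_smoothMangoldt (K : ℕ) (P : ℕ → Prop) [DecidablePred P] :
    Summable fun n => if P n then smoothMangoldt K n else 0 :=
  (summable_smoothMangoldt K).of_nonneg_of_le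
    (fun n => by split_ifs <;> simp [smoothMangoldt_nonneg])
    (fun n => by split_ifs <;> simp [smoothMangoldt_nonneg])

/-- Half of the decay n^(-1/K) pays for log n ≤ 2K n^(1/(2K)); the other half keeps the series
convergent. -/
theorem smoothMangoldt_le_rpow {K : ℕ} (hK : 2 ≤ K) {n : ℕ} (hn : n ≠ 0) :
    smoothMangoldt K n ≤ 8 * K * (n : ℝ) ^ (-(1 + 1 / (2 * K : ℝ))) := by
  have hn1 := one_le_cast_of_ne_zero hn
  have hn0 : (0 : ℝ) < n := by linarith
  have hK0 : (0 : ℝ) < K := by positivity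
  have hlog : Real.log n ≤ 2 * K * (n : ℝ) ^ (1 / (2 * K : ℝ)) := by
    have := Real.log_le_rpow_div hn0.le (by positivity : (0 : ℝ) < 1 / (2 * K))
    refine this.trans (le_of_eq ?_)
    field_simp
  calc smoothMangoldt K n
      ≤ 2 * K * (n : ℝ) ^ (1 / (2 * K : ℝ)) / n * (4 * (n : ℝ) ^ (-(1 / (K : ℝ)))) := by
        refine mul_le_mul ?_ (poissonWeight_le_rpow hK hn1) (poissonWeight_nonneg K hn1)
          (by positivity)
        exact div_le_div_of_nonneg_right (vonMangoldt_le_log.trans hlog) hn0.le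
    _ = 8 * K * ((n : ℝ) ^ (1 / (2 * K : ℝ)) * (n : ℝ) ^ (-(1 / (K : ℝ))) * (n : ℝ) ^ (-1 : ℝ)) := by
        rw [Real.rpow_neg_one]; ring
    _ = _ := by
        rw [← Real.rpow_add hn0, ← Real.rpow_add hn0]
        congr 2
        field_simp
        ring

/-- The integral-test bound for ζ(1 + ε), obtained by telescoping M^(-ε)/ε. -/
theorem tsum_rpow_neg_one_add_le {ε : ℝ} (hε : 0 < ε) :
    Summable (fun k : ℕ => ((k + 1 : ℕ) : ℝ) ^ (-(1 + ε))) ∧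
      ∑' k : ℕ, ((k + 1 : ℕ) : ℝ) ^ (-(1 + ε)) ≤ 1 + 1 / ε := by
  have hstep : ∀ M : ℕ, 1 ≤ M → ((M + 1 : ℕ) : ℝ) ^ (-(1 + ε))
      ≤ 1 / ε * ((M : ℝ) ^ (-ε) - ((M + 1 : ℕ) : ℝ) ^ (-ε)) := fun M hM => by
    have hM0 : (0 : ℝ) < M := by exact_mod_cast hM
    set y : ℝ := ((M + 1 : ℕ) : ℝ) with hy
    have hyM : y = M + 1 := by rw [hy]; push_cast; ring
    have hy0 : 0 < y := by positivity
    have h1 : (M : ℝ) ^ (-ε) = y ^ (-ε) * ((M : ℝ) / y) ^ (-ε) := by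
      rw [← Real.mul_rpow hy0.le (by positivity), mul_div_cancel₀ _ hy0.ne']
    have h2 : 1 + ε / y ≤ ((M : ℝ) / y) ^ (-ε) := by
      have hpos : 0 < (M : ℝ) / y := by positivity
      rw [Real.rpow_def_of_pos hpos]
      have hl := Real.log_le_sub_one_of_pos hpos
      have h3 : (M : ℝ) / y - 1 = -(1 / y) := by rw [hyM]; field_simp; ring
      rw [h3] at hl
      have h4 : ε / y ≤ Real.log ((M : ℝ) / y) * -ε := by
        have : ε / y = -(1 / y) * -ε := by ring
        rw [this]
        exact mul_le_mul_of_nonpos_right hl (by linarith)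
      linarith [Real.add_one_le_exp (Real.log ((M : ℝ) / y) * -ε)]
    have h5 : y ^ (-(1 + ε)) = y ^ (-ε) * y⁻¹ := by
      rw [neg_add_rev, Real.rpow_add hy0, Real.rpow_neg_one]
    rw [h1, h5]
    have h6 : 0 < y ^ (-ε) := by positivity
    have h7 : y ^ (-ε) * (1 + ε / y) ≤ y ^ (-ε) * ((M : ℝ) / y) ^ (-ε) := by gcongr
    rw [div_mul_eq_mul_div, one_mul, le_div_iff₀ hε]
    have h8 : y ^ (-ε) * y⁻¹ * ε = y ^ (-ε) * (1 + ε / y) - y ^ (-ε) := by ring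
    linarith
  have hsum : ∀ M : ℕ, ∑ k ∈ Finset.range (M + 1), ((k + 1 : ℕ) : ℝ) ^ (-(1 + ε))
      ≤ 1 + 1 / ε - 1 / ε * ((M + 1 : ℕ) : ℝ) ^ (-ε) := fun M => by
    induction M with
    | zero => simp
    | succ M ih =>
      rw [Finset.sum_range_succ]
      have := hstep (M + 1) (by omega)
      linarith
  have hb : ∀ M : ℕ, ∑ k ∈ Finset.range M, ((k + 1 : ℕ) : ℝ) ^ (-(1 + ε)) ≤ 1 + 1 / ε := fun M => by
    refine le_trans (Finset.sum_le_sum_of_subset_of_nonneg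
      (Finset.range_mono (Nat.le_succ M)) fun _ _ _ => by positivity) ((hsum M).trans ?_)
    have : 0 ≤ 1 / ε * ((M + 1 : ℕ) : ℝ) ^ (-ε) := by positivity
    linarith
  exact ⟨summable_of_sum_range_le (fun _ => by positivity) hb,
    Real.tsum_le_of_sum_range_le (fun _ => by positivity) hb⟩

/-- The term n = r is the main term, and smoothing changes it by at most Λ(r)/q. For k ≥ 1, r + kq ≥
kq, so the tail is at most (8K/q) ζ(1 + 1/(2K)). -/
theorem abs_tsum_modEq_sub_le {q K r : ℕ} (hK : 2 ≤ K) (hqK : (2 : ℝ)⁻¹ ^ K ≤ (q : ℝ)⁻¹)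
    (hr0 : 0 < r) (hrq : r < q) :
    |∑' n : ℕ, (if n ≡ r [MOD q] then smoothMangoldt K n else 0) - vonMangoldt r / r|
      ≤ (Real.log q + 8 * K * (1 + 2 * K)) / q := by
  have hq0 : (0 : ℝ) < q := by exact_mod_cast hr0.trans hrq
  have hK0 : (0 : ℝ) < K := by positivity
  have hinj : Function.Injective fun k : ℕ => r + k * q := fun i j h =>
    Nat.eq_of_mul_eq_mul_right (hr0.trans hrq) (Nat.add_left_cancel h)
  have hre : ∑' n : ℕ, (if n ≡ r [MOD q] then smoothMangoldt K n else 0)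
      = ∑' k : ℕ, smoothMangoldt K (r + k * q) := by
    rw [← hinj.tsum_eq]
    · refine tsum_congr fun k => if_pos ?_
      simp [Nat.ModEq]
    · intro n hn
      have hmod : n ≡ r [MOD q] := by
        by_contra h
        exact hn (if_neg h)
      refine ⟨n / q, ?_⟩
      have h1 : n % q = r := by
        have := hmod
        rwa [Nat.ModEq, Nat.mod_eq_of_lt hrq] at this
      have := Nat.mod_add_div n q
      rw [h1] at this
      simp only
      rw [mul_comm]
      exact this
  have hsum : Summable fun k : ℕ => smoothMangoldt K (r + k * q) :=
    (summable_smoothMangoldt K).comp_injective hinj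
  obtain ⟨hs, hle⟩ := tsum_rpow_neg_one_add_le (ε := 1 / (2 * K : ℝ)) (by positivity)
  have hterm : ∀ k : ℕ, smoothMangoldt K (r + (k + 1) * q)
      ≤ 8 * K / q * ((k + 1 : ℕ) : ℝ) ^ (-(1 + 1 / (2 * K : ℝ))) := fun k => by
    refine (smoothMangoldt_le_rpow hK (by omega)).trans ?_
    have hk : (0 : ℝ) < ((k + 1 : ℕ) : ℝ) := by positivity
    have h1 : ((k + 1 : ℕ) : ℝ) * q ≤ ((r + (k + 1) * q : ℕ) : ℝ) := by
      exact_mod_cast Nat.le_add_left _ _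
    have h2 : ((r + (k + 1) * q : ℕ) : ℝ) ^ (-(1 + 1 / (2 * K : ℝ)))
        ≤ (((k + 1 : ℕ) : ℝ) * q) ^ (-(1 + 1 / (2 * K : ℝ))) :=
      Real.rpow_le_rpow_of_nonpos (by positivity) h1 (by
        have : 0 < 1 / (2 * K : ℝ) := by positivity
        linarith)
    have h3 : (q : ℝ) ^ (-(1 + 1 / (2 * K : ℝ))) ≤ (q : ℝ)⁻¹ := by
      rw [← Real.rpow_neg_one]
      refine Real.rpow_le_rpow_of_exponent_le (one_le_cast_of_ne_zero (by omega)) ?_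
      have : 0 < 1 / (2 * K : ℝ) := by positivity
      linarith
    rw [Real.mul_rpow hk.le hq0.le] at h2
    calc _ ≤ 8 * K * (((k + 1 : ℕ) : ℝ) ^ (-(1 + 1 / (2 * K : ℝ))) * (q : ℝ)⁻¹) := by
          refine mul_le_mul_of_nonneg_left (h2.trans ?_) (by positivity)
          exact mul_le_mul_of_nonneg_left h3 (by positivity)
      _ = _ := by ring
  have htail : ∑' k : ℕ, smoothMangoldt K (r + (k + 1) * q) ≤ 8 * K * (1 + 2 * K) / q := by
    have h1 := ((summable_nat_add_iff 1).2 hsum).tsum_le_tsum hterm (hs.mul_left _)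
    rw [tsum_mul_left] at h1
    refine h1.trans ?_
    rw [one_div_one_div] at hle
    calc _ ≤ 8 * K / q * (1 + 2 * (K : ℝ)) := by gcongr
      _ = _ := by ring
  have htail0 : 0 ≤ ∑' k : ℕ, smoothMangoldt K (r + (k + 1) * q) :=
    tsum_nonneg fun _ => smoothMangoldt_nonneg _ _
  have hmain := abs_smoothMangoldt_sub_le K r
  have hmain2 : vonMangoldt r * (2 : ℝ)⁻¹ ^ K ≤ Real.log q / q := by
    rw [div_eq_mul_inv]
    refine mul_le_mul (vonMangoldt_le_log.trans ?_) hqK (by positivity)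
      (Real.log_nonneg (one_le_cast_of_ne_zero (by omega)))
    exact Real.log_le_log (by exact_mod_cast hr0) (by exact_mod_cast hrq.le)
  rw [hre, hsum.tsum_eq_zero_add, zero_mul, add_zero, add_sub_right_comm, add_div]
  refine (abs_add_le _ _).trans (add_le_add (hmain.trans hmain2) ?_)
  rwa [abs_of_nonneg htail0]

/-! ### Powers of the primes dividing q -/

theorem tsum_ite_inv_pow_le {p k₀ : ℕ} (hp : 2 ≤ p) :
    Summable (fun k : ℕ => if k₀ ≤ k then ((p : ℝ) ^ (k + 1))⁻¹ else 0) ∧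
    ∑' k : ℕ, (if k₀ ≤ k then ((p : ℝ) ^ (k + 1))⁻¹ else 0) ≤ 2 * ((p : ℝ) ^ (k₀ + 1))⁻¹ := by
  have hp2 : (2 : ℝ) ≤ p := by exact_mod_cast hp
  have hinv : (p : ℝ)⁻¹ ≤ 1 / 2 := by rw [one_div]; gcongr
  have hg := (hasSum_geometric_of_lt_one (r := (p : ℝ)⁻¹) (by positivity) (by linarith)).mul_left
    ((p : ℝ) ^ (k₀ + 1))⁻¹
  have h0 : ∑ k ∈ Finset.range k₀, (if k₀ ≤ k then ((p : ℝ) ^ (k + 1))⁻¹ else 0) = 0 :=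
    Finset.sum_eq_zero fun k hk => if_neg (by have := Finset.mem_range.1 hk; omega)
  have h : HasSum (fun k : ℕ => if k₀ ≤ k then ((p : ℝ) ^ (k + 1))⁻¹ else 0)
      (((p : ℝ) ^ (k₀ + 1))⁻¹ * (1 - (p : ℝ)⁻¹)⁻¹) := by
    rw [← hasSum_nat_add_iff' k₀, h0, sub_zero]
    refine hg.congr_fun fun k => ?_
    rw [if_pos (Nat.le_add_left _ _), inv_pow, ← mul_inv, ← pow_add]
    congr 2
    ring
  refine ⟨h.summable, h.tsum_eq.le.trans ?_⟩
  rw [mul_comm]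
  gcongr
  rw [inv_le_comm₀ (by linarith) (by norm_num)]
  linarith

theorem vonMangoldt_prime_pow_succ {p : ℕ} (hp : p.Prime) (k : ℕ) :
    vonMangoldt (p ^ (k + 1)) = Real.log p := by
  rw [vonMangoldt_apply_pow (Nat.succ_ne_zero k), vonMangoldt_apply_prime hp]

theorem hTerm_of_forall_not {q p : ℕ} {r : (ZMod q)ˣ}
    (h : ∀ k : ℕ, ¬p ^ (k + 1) ≡ ((r⁻¹ : (ZMod q)ˣ) : ZMod q).val
      [MOD q / p ^ q.factorization p]) : hTerm q p r = 0 := by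
  have : eExp q p r = ⊤ := by
    rw [eExp, sInf_eq_top]
    rintro x ⟨e, -, he1, he⟩
    obtain ⟨k, rfl⟩ := Nat.exists_eq_add_of_le' he1
    exact absurd he (h k)
  rw [hTerm, if_pos this]

theorem hTerm_of_least {q p : ℕ} {r : (ZMod q)ˣ} {j : ℕ}
    (hj : p ^ (j + 1) ≡ ((r⁻¹ : (ZMod q)ˣ) : ZMod q).val [MOD q / p ^ q.factorization p])
    (hmin : ∀ k : ℕ, p ^ (k + 1) ≡ ((r⁻¹ : (ZMod q)ˣ) : ZMod q).val
      [MOD q / p ^ q.factorization p] → j ≤ k) :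
    hTerm q p r = 1 / (Nat.totient (p ^ q.factorization p) : ℝ) *
      (Real.log p / (p : ℝ) ^ (j + 1)) := by
  have : eExp q p r = ((j + 1 : ℕ) : ℕ∞) := by
    refine le_antisymm (sInf_le ⟨j + 1, rfl, by omega, hj⟩) (le_sInf ?_)
    rintro x ⟨e, rfl, he1, he⟩
    obtain ⟨k, rfl⟩ := Nat.exists_eq_add_of_le' he1
    exact_mod_cast Nat.succ_le_succ (hmin k he)
  rw [hTerm, this, if_neg (ENat.natCast_ne_top _), ENat.toNat_natCast]

theorem le_pow_of_pow_modEq_one {p m j : ℕ} (hp : 2 ≤ p) (hj : j ≠ 0)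
    (h : p ^ j ≡ 1 [MOD m]) : m ≤ p ^ j := by
  have h1 : 1 < p ^ j := Nat.one_lt_pow hj (by omega)
  have h2 := (Nat.modEq_iff_dvd' h1.le).1 h.symm
  have := Nat.le_of_dvd (by omega) h2
  omega

/-- Cancelling p^(j+1) leaves p^(k-j) ≡ 1, so p^(k-j) ≥ m; the spare factor p^(j+1) ≥ p gives the
rest. -/
theorem mul_le_pow_of_pow_modEq_pow {p m j k : ℕ} (hp : p.Prime) (hpm : p.Coprime m)
    (hjk : j < k) (h : p ^ (k + 1) ≡ p ^ (j + 1) [MOD m]) : m * p ≤ p ^ (k + 1) := by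
  obtain ⟨i, rfl⟩ := Nat.exists_eq_add_of_lt hjk
  have h1 : p ^ (i + 1) ≡ 1 [MOD m] := by
    have h2 : p ^ (j + 1) * p ^ (i + 1) ≡ p ^ (j + 1) * 1 [MOD m] := by
      rw [mul_one, ← pow_add]
      convert h using 2
      ring
    exact Nat.ModEq.cancel_left_of_coprime ((hpm.pow_left _).symm) h2
  calc m * p ≤ p ^ (i + 1) * p :=
        Nat.mul_le_mul_right _ (le_pow_of_pow_modEq_one hp.two_le (Nat.succ_ne_zero i) h1)
    _ = p ^ (i + 2) := by ring
    _ ≤ p ^ (j + i + 1 + 1) := Nat.pow_le_pow_right hp.pos (by omega)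

theorem coprime_div_pow_factorization {q p : ℕ} (hq : q ≠ 0) (hp : p.Prime) :
    p.Coprime (q / p ^ q.factorization p) :=
  Nat.coprime_ordCompl hp hq

theorem le_totient_mul {q p : ℕ} (hp : p.Prime) (hpq : p ∣ q) (hq : q ≠ 0) :
    q ≤ (p ^ q.factorization p).totient * (q / p ^ q.factorization p * p) := by
  have hν : 0 < q.factorization p := hp.factorization_pos_of_dvd hq hpq
  rw [Nat.totient_prime_pow hp hν]
  have h1 : p ^ q.factorization p * (q / p ^ q.factorization p) = q := Nat.ordProj_mul_ordCompl_eq_self q p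
  have h2 : p ^ (q.factorization p - 1) * p = p ^ q.factorization p := by
    rw [← pow_succ, Nat.sub_add_cancel hν]
  calc q = p ^ (q.factorization p - 1) * p * (q / p ^ q.factorization p) := by rw [h2, h1]
    _ ≤ p ^ (q.factorization p - 1) * p * (q / p ^ q.factorization p) * (p - 1) :=
        Nat.le_mul_of_pos_right _ (Nat.sub_pos_of_lt hp.one_lt)
    _ = _ := by ring

theorem le_two_mul_totient_mul {q p : ℕ} (hp : p.Prime) (hpq : p ∣ q) (hq : q ≠ 0) :
    q ≤ 2 * ((p ^ q.factorization p).totient * (q / p ^ q.factorization p)) := by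
  have hν : 0 < q.factorization p := hp.factorization_pos_of_dvd hq hpq
  rw [Nat.totient_prime_pow hp hν]
  have h1 : p ^ q.factorization p * (q / p ^ q.factorization p) = q := Nat.ordProj_mul_ordCompl_eq_self q p
  have h2 : p ^ (q.factorization p - 1) * p = p ^ q.factorization p := by
    rw [← pow_succ, Nat.sub_add_cancel hν]
  have h3 : p ≤ 2 * (p - 1) := by have := hp.two_le; omega
  calc q = p ^ (q.factorization p - 1) * (q / p ^ q.factorization p) * p := by
        rw [mul_right_comm, h2, h1]
    _ ≤ p ^ (q.factorization p - 1) * (q / p ^ q.factorization p) * (2 * (p - 1)) :=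
        Nat.mul_le_mul_left _ h3
    _ = _ := by ring

/-- p^e ≡ 1 modulo m = q/p^ν with e ≥ 1 forces p^e ≥ m, while φ(p^ν) m ≥ q/2. Hence the class of 1
contributes only to the error. -/
theorem hTerm_one_le {q p : ℕ} (hq : 2 ≤ q) (hp : p.Prime) (hpq : p ∣ q) :
    0 ≤ hTerm q p 1 ∧ hTerm q p 1 ≤ 2 * Real.log p / q := by
  have hlog : 0 ≤ Real.log p := Real.log_natCast_nonneg p
  refine ⟨by unfold hTerm; split_ifs <;> positivity, ?_⟩
  set m := q / p ^ q.factorization p with hm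
  by_cases hex : ∃ k : ℕ, p ^ (k + 1) ≡ (((1 : (ZMod q)ˣ)⁻¹ : (ZMod q)ˣ) : ZMod q).val [MOD m]
  · classical
    have hj := Nat.find_spec hex
    set j := Nat.find hex
    rw [hTerm_of_least hj (fun k hk => Nat.find_min' hex hk)]
    have : Fact (1 < q) := ⟨hq⟩
    rw [inv_one, Units.val_one, ZMod.val_one] at hj
    have h1 : m ≤ p ^ (j + 1) := le_pow_of_pow_modEq_one hp.two_le (Nat.succ_ne_zero j) hj
    have h2 := le_two_mul_totient_mul hp hpq (by omega)
    have h3 : (q : ℝ) ≤ 2 * ((p ^ q.factorization p).totient * (p : ℝ) ^ (j + 1)) := by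
      have : q ≤ 2 * ((p ^ q.factorization p).totient * p ^ (j + 1)) :=
        h2.trans (Nat.mul_le_mul_left _ (Nat.mul_le_mul_left _ h1))
      exact_mod_cast this
    have hφ : (0 : ℝ) < (p ^ q.factorization p).totient := by
      exact_mod_cast Nat.totient_pos.2 (pow_pos hp.pos _)
    have hp0 : (0 : ℝ) < p := by exact_mod_cast hp.pos
    have hq0 : (0 : ℝ) < q := by positivity
    rw [div_mul_div_comm, one_mul, div_le_div_iff₀ (by positivity) hq0]
    nlinarith
  · rw [hTerm_of_forall_not (not_exists.1 hex)]
    positivity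

/-- The least admissible power gives h. Later ones are at least mp, where m = q/p^ν, so their
geometric sum is at most 2 log p/(mp), and φ(p^ν) mp ≥ q. Smoothing the first costs another log p/q.
-/
theorem abs_tsum_pow_modEq_sub_le {q K p : ℕ} [NeZero q] (hqK : (2 : ℝ)⁻¹ ^ K ≤ (q : ℝ)⁻¹)
    (hp : p.Prime) (hpq : p ∣ q) (u : (ZMod q)ˣ) :
    |1 / (Nat.totient (p ^ q.factorization p) : ℝ) *
      ∑' k : ℕ, (if p ^ (k + 1) ≡ (u : ZMod q).val [MOD q / p ^ q.factorization p]
        then smoothMangoldt K (p ^ (k + 1)) else 0) - hTerm q p u⁻¹|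
      ≤ 3 * Real.log p / q := by
  classical
  have hlog : 0 ≤ Real.log p := Real.log_natCast_nonneg p
  have hq := NeZero.ne q
  have hq0 : (0 : ℝ) < q := by exact_mod_cast NeZero.pos q
  have hp0 : (0 : ℝ) < p := by exact_mod_cast hp.pos
  have hφ : (1 : ℝ) ≤ (p ^ q.factorization p).totient := by
    exact_mod_cast Nat.totient_pos.2 (pow_pos hp.pos _)
  set φ : ℝ := ((p ^ q.factorization p).totient : ℝ) with hφdef
  have hcop := coprime_div_pow_factorization hq hp
  have hqm := le_totient_mul hp hpq hq
  set m := q / p ^ q.factorization p with hm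
  by_cases hex : ∃ k : ℕ, p ^ (k + 1) ≡ (u : ZMod q).val [MOD m]
  swap
  · rw [hTerm_of_forall_not (by rw [inv_inv]; exact not_exists.1 hex)]
    have h0 : ∀ k : ℕ, (if p ^ (k + 1) ≡ (u : ZMod q).val [MOD m]
        then smoothMangoldt K (p ^ (k + 1)) else 0) = 0 := fun k => if_neg (not_exists.1 hex k)
    simp only [h0, tsum_zero, mul_zero, sub_zero, abs_zero]
    positivity
  have hj := Nat.find_spec hex
  have hmin : ∀ k : ℕ, p ^ (k + 1) ≡ (u : ZMod q).val [MOD m] → Nat.find hex ≤ k :=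
    fun k hk => Nat.find_min' hex hk
  set j := Nat.find hex
  rw [hTerm_of_least (j := j) (by rw [inv_inv]; exact hj) (by rw [inv_inv]; exact hmin)]
  have hsum : Summable fun k : ℕ => if p ^ (k + 1) ≡ (u : ZMod q).val [MOD m]
        then smoothMangoldt K (p ^ (k + 1)) else 0 :=
    (summable_ite_smoothMangoldt K (fun n => n ≡ (u : ZMod q).val [MOD m])).comp_injective
      (fun a b h => by simpa using Nat.pow_right_injective hp.two_le h)
  rw [hsum.tsum_eq_add_tsum_ite j, if_pos hj]
  have hm0 : 0 < m := Nat.pos_of_ne_zero fun h => by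
    rw [h, zero_mul, mul_zero] at hqm; omega
  have hex2 : ∃ k : ℕ, m * p ≤ p ^ (k + 1) :=
    ⟨m, by rw [pow_succ]; exact Nat.mul_le_mul_right _ (Nat.lt_pow_self hp.one_lt).le⟩
  have hk₀ := Nat.find_spec hex2
  have hk₀min : ∀ k : ℕ, m * p ≤ p ^ (k + 1) → Nat.find hex2 ≤ k := fun k hk => Nat.find_min' hex2 hk
  set k₀ := Nat.find hex2
  obtain ⟨hgs, hgle⟩ := tsum_ite_inv_pow_le (k₀ := k₀) hp.two_le
  set R := ∑' k : ℕ, (if k = j then 0 else if p ^ (k + 1) ≡ (u : ZMod q).val [MOD m]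
        then smoothMangoldt K (p ^ (k + 1)) else 0) with hR
  have hnn : ∀ k : ℕ, 0 ≤ (if k = j then 0 else if p ^ (k + 1) ≡ (u : ZMod q).val [MOD m]
        then smoothMangoldt K (p ^ (k + 1)) else 0) := fun k => by
    split_ifs <;> simp [smoothMangoldt_nonneg]
  have hR0 : 0 ≤ R := tsum_nonneg hnn
  have hterm : ∀ k : ℕ, (if k = j then 0 else if p ^ (k + 1) ≡ (u : ZMod q).val [MOD m]
        then smoothMangoldt K (p ^ (k + 1)) else 0)
      ≤ Real.log p * (if k₀ ≤ k then ((p : ℝ) ^ (k + 1))⁻¹ else 0) := fun k => by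
    have hnn' : 0 ≤ Real.log p * (if k₀ ≤ k then ((p : ℝ) ^ (k + 1))⁻¹ else 0) :=
      mul_nonneg hlog (by split_ifs <;> positivity)
    by_cases hkj : k = j
    · rwa [if_pos hkj]
    rw [if_neg hkj]
    by_cases hk : p ^ (k + 1) ≡ (u : ZMod q).val [MOD m]
    · have hlt : j < k := lt_of_le_of_ne (hmin k hk) (Ne.symm hkj)
      rw [if_pos hk, if_pos (hk₀min k (mul_le_pow_of_pow_modEq_pow hp hcop hlt (hk.trans hj.symm)))]
      refine (smoothMangoldt_le K _).trans (le_of_eq ?_)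
      rw [vonMangoldt_prime_pow_succ hp, div_eq_mul_inv]
      push_cast
      rfl
    · rwa [if_neg hk]
  have hRle : R ≤ Real.log p * (2 * ((m : ℝ) * p)⁻¹) := by
    have h1 := (Summable.of_nonneg_of_le hnn hterm (hgs.mul_left _)).tsum_le_tsum hterm
      (hgs.mul_left _)
    rw [tsum_mul_left] at h1
    refine h1.trans (mul_le_mul_of_nonneg_left (hgle.trans ?_) hlog)
    have : (m : ℝ) * p ≤ (p : ℝ) ^ (k₀ + 1) := by exact_mod_cast hk₀
    have hm0' : (0 : ℝ) < m := by exact_mod_cast hm0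
    gcongr
  have hRφ : 1 / φ * R ≤ 2 * Real.log p / q := by
    have hm0' : (0 : ℝ) < m := by exact_mod_cast hm0
    have hqm' : (q : ℝ) ≤ φ * (m * p) := by rw [hφdef]; exact_mod_cast hqm
    calc 1 / φ * R ≤ 1 / φ * (Real.log p * (2 * ((m : ℝ) * p)⁻¹)) := by gcongr
      _ = 2 * Real.log p / (φ * (m * p)) := by field_simp
      _ ≤ _ := by gcongr
  have hmain := abs_smoothMangoldt_sub_le K (p ^ (j + 1))
  rw [vonMangoldt_prime_pow_succ hp, Nat.cast_pow] at hmain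
  have hmain2 : |1 / φ * (smoothMangoldt K (p ^ (j + 1)) - Real.log p / (p : ℝ) ^ (j + 1))|
      ≤ Real.log p / q := by
    rw [abs_mul, abs_of_nonneg (by positivity : 0 ≤ 1 / φ), div_eq_mul_inv (Real.log p)]
    calc _ ≤ 1 * (Real.log p * (2 : ℝ)⁻¹ ^ K) := by
          refine mul_le_mul ?_ hmain (abs_nonneg _) zero_le_one
          rw [div_le_one (by linarith)]
          exact hφ
      _ ≤ _ := by rw [one_mul]; exact mul_le_mul_of_nonneg_left hqK hlog
  have hsplit : 1 / φ * (smoothMangoldt K (p ^ (j + 1)) + R)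
      - 1 / φ * (Real.log p / (p : ℝ) ^ (j + 1))
      = 1 / φ * (smoothMangoldt K (p ^ (j + 1)) - Real.log p / (p : ℝ) ^ (j + 1)) + 1 / φ * R := by
    ring
  rw [hsplit]
  refine (abs_add_le _ _).trans ?_
  rw [abs_of_nonneg (by positivity : 0 ≤ 1 / φ * R)]
  have : 3 * Real.log p / q = Real.log p / q + 2 * Real.log p / q := by ring
  rw [this]
  exact add_le_add hmain2 hRφ

theorem sum_log_primeFactors_le {q : ℕ} (hq : q ≠ 0) :
    ∑ p ∈ q.primeFactors, Real.log p ≤ Real.log q := by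
  rw [← Real.log_prod fun p hp => Nat.cast_ne_zero.2 (Nat.prime_of_mem_primeFactors hp).ne_zero,
    ← Nat.cast_prod]
  refine Real.log_le_log ?_ ?_
  · exact_mod_cast Finset.prod_pos fun p hp => (Nat.prime_of_mem_primeFactors hp).pos
  · exact_mod_cast Nat.le_of_dvd (Nat.pos_of_ne_zero hq) (Nat.prod_primeFactors_dvd q)

/-! ### Collecting the contributions to one class -/

open Classical in
/-- The contribution of `n` to the prime-power sum attached to the residue class `u`: from the
class modulo `q`, and from powers of primes dividing `q`. -/
noncomputable def classTerm {q : ℕ} (K : ℕ) (u : (ZMod q)ˣ) (n : ℕ) : ℝ :=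
  (if n ≡ (u : ZMod q).val [MOD q] then smoothMangoldt K n else 0) +
    ∑ p ∈ q.primeFactors, 1 / (Nat.totient (p ^ q.factorization p) : ℝ) *
      (if (∃ k : ℕ, p ^ (k + 1) = n) ∧ n ≡ (u : ZMod q).val [MOD q / p ^ q.factorization p]
        then smoothMangoldt K n else 0)

theorem summable_classTerm {q : ℕ} (K : ℕ) (u : (ZMod q)ˣ) : Summable (classTerm K u) := by
  classical
  unfold classTerm
  exact (summable_ite_smoothMangoldt K _).add
    (summable_sum fun p _ => (summable_ite_smoothMangoldt K _).mul_left _)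

theorem tsum_classTerm {q : ℕ} (K : ℕ) (u : (ZMod q)ˣ) :
    ∑' n, classTerm K u n = ∑' n : ℕ, (if n ≡ (u : ZMod q).val [MOD q] then smoothMangoldt K n else 0)
      + ∑ p ∈ q.primeFactors, 1 / (Nat.totient (p ^ q.factorization p) : ℝ) *
        ∑' k : ℕ, (if p ^ (k + 1) ≡ (u : ZMod q).val [MOD q / p ^ q.factorization p]
          then smoothMangoldt K (p ^ (k + 1)) else 0) := by
  classical
  unfold classTerm
  rw [(summable_ite_smoothMangoldt K _).tsum_add
    (summable_sum fun p _ => (summable_ite_smoothMangoldt K _).mul_left _),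
    Summable.tsum_finsetSum fun p _ => (summable_ite_smoothMangoldt K _).mul_left _]
  congr 1
  refine Finset.sum_congr rfl fun p hp => ?_
  have hp' := Nat.prime_of_mem_primeFactors hp
  rw [tsum_mul_left]
  congr 1
  have hinj : Function.Injective fun k : ℕ => p ^ (k + 1) := fun a b h => by
    simpa using Nat.pow_right_injective hp'.two_le h
  rw [← hinj.tsum_eq]
  · simp
  · intro n hn
    by_contra h
    exact hn (if_neg fun h' => h h'.1)

/-- Only prime powers n = p^(k+1) matter. If p ∤ q, orthogonality holds modulo q itself; if p ∣ q,
it holds modulo q/p^ν, whose totient is φ(q)/φ(p^ν). -/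
theorem smoothMangoldt_mul_sum_char {q : ℕ} [NeZero q] (K : ℕ) (u : (ZMod q)ˣ) (n : ℕ) :
    (smoothMangoldt K n : ℂ) * ∑ χ : DirichletCharacter ℂ q,
        χ ((u⁻¹ : (ZMod q)ˣ) : ZMod q) * χ.primitiveCharacter (n : ZMod χ.conductor)
      = q.totient * classTerm K u n := by
  classical
  by_cases hΛ : vonMangoldt n = 0
  · have : smoothMangoldt K n = 0 := by rw [smoothMangoldt, hΛ]; simp
    simp [classTerm, this]
  obtain ⟨p, k, hp, hk, rfl⟩ := (isPrimePow_nat_iff n).1 (ArithmeticFunction.vonMangoldt_ne_zero_iff.1 hΛ)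
  obtain ⟨k, rfl⟩ := Nat.exists_eq_succ_of_ne_zero hk.ne'
  have hval : ((u : ZMod q).val).Coprime q := ZMod.val_coe_unit_coprime u
  have hpp : ∀ p' ∈ q.primeFactors, (∃ k' : ℕ, p' ^ (k' + 1) = p ^ (k + 1)) → p' = p :=
    fun p' hp' ⟨k', h⟩ => (Nat.Prime.pow_inj' (Nat.prime_of_mem_primeFactors hp') hp (Nat.succ_ne_zero k')
      (Nat.succ_ne_zero k) h).1
  by_cases hpq : p ∣ q
  · have hpmem : p ∈ q.primeFactors := Nat.mem_primeFactors.2 ⟨hp, hpq, NeZero.ne q⟩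
    have hcop := coprime_div_pow_factorization (NeZero.ne q) hp
    -- A multiple of p cannot lie in a unit class modulo q, so the first summand of `classTerm`
    -- vanishes.
    have hnot : ¬p ^ k.succ ≡ (u : ZMod q).val [MOD q] := fun h => by
      have h1 : (p ^ k.succ).Coprime q := by
        rw [Nat.Coprime, h.gcd_eq]
        exact hval
      exact Nat.not_coprime_of_dvd_of_dvd hp.one_lt (dvd_pow_self p (Nat.succ_ne_zero k)) hpq h1
    rw [sum_inv_mul_primitiveCharacter (m := q / p ^ q.factorization p) (Nat.ordCompl_dvd q p)
      (hcop.pow_left _) (fun c hc hcop' => ?_)]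
    · rw [classTerm, if_neg hnot, Finset.sum_eq_single p, zero_add]
      · have htot : q.totient = (p ^ q.factorization p).totient *
            (q / p ^ q.factorization p).totient := by
          rw [← Nat.totient_mul (hcop.pow_left _), Nat.ordProj_mul_ordCompl_eq_self]
        have hφ : ((p ^ q.factorization p).totient : ℂ) ≠ 0 :=
          Nat.cast_ne_zero.2 (Nat.totient_pos.2 (pow_pos hp.pos _)).ne'
        have hex : ∃ k' : ℕ, p ^ (k' + 1) = p ^ (k + 1) := ⟨k, rfl⟩
        simp only [Nat.succ_eq_add_one, hex, true_and]
        split_ifs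
        · rw [htot]; push_cast; field_simp
        · simp
      · intro p' hp' hne
        rw [if_neg fun h => hne (hpp p' hp' h.1), mul_zero]
      · exact fun h => absurd hpmem h
    · have h1 : c.Coprime (p ^ q.factorization p) :=
        ((Nat.coprime_pow_left_iff (Nat.succ_pos k) p c).1 hcop').symm.pow_right _
      refine h1.dvd_of_dvd_mul_left ?_
      rwa [Nat.ordProj_mul_ordCompl_eq_self]
  · have hcop : (p ^ (k + 1)).Coprime q := ((hp.coprime_iff_not_dvd).2 hpq).pow_left _
    rw [sum_inv_mul_primitiveCharacter dvd_rfl hcop (fun c hc _ => hc), classTerm,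
      Finset.sum_eq_zero, add_zero]
    · split_ifs
      · ring
      · simp
    · intro p' hp'
      rw [if_neg, mul_zero]
      rintro ⟨h, -⟩
      exact hpq (hpp p' hp' h ▸ Nat.dvd_of_mem_primeFactors hp')

theorem abs_tsum_classTerm_sub_le {q K : ℕ} [NeZero q] (hq : 2 ≤ q) (hK : 2 ≤ K)
    (hqK : (2 : ℝ)⁻¹ ^ K ≤ (q : ℝ)⁻¹) (u : (ZMod q)ˣ) :
    |∑' n, classTerm K u n - (vonMangoldt (u : ZMod q).val / ((u : ZMod q).val : ℝ)
      + ∑ p ∈ q.primeFactors, hTerm q p u⁻¹)|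
      ≤ (4 * Real.log q + 8 * K * (1 + 2 * K)) / q := by
  have hr0 : 0 < (u : ZMod q).val := by
    have h := ZMod.val_coe_unit_coprime u
    refine Nat.pos_of_ne_zero fun h0 => ?_
    rw [h0, Nat.coprime_zero_left] at h
    omega
  have h1 := abs_tsum_modEq_sub_le hK hqK hr0 (ZMod.val_lt (u : ZMod q))
  rw [tsum_classTerm, add_sub_add_comm, ← Finset.sum_sub_distrib]
  have hq0 : (0 : ℝ) < q := by positivity
  have h2 : ∑ p ∈ q.primeFactors, 3 * Real.log p / q ≤ 3 * Real.log q / q := by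
    rw [← Finset.sum_div, ← Finset.mul_sum]
    have := sum_log_primeFactors_le (NeZero.ne q)
    gcongr
  have h3 := (Finset.abs_sum_le_sum_abs (fun p => 1 / (Nat.totient (p ^ q.factorization p) : ℝ) *
      ∑' k : ℕ, (if p ^ (k + 1) ≡ (u : ZMod q).val [MOD q / p ^ q.factorization p]
        then smoothMangoldt K (p ^ (k + 1)) else 0) - hTerm q p u⁻¹) q.primeFactors).trans
    (Finset.sum_le_sum fun p hp => abs_tsum_pow_modEq_sub_le hqK (Nat.prime_of_mem_primeFactors hp)
      (Nat.dvd_of_mem_primeFactors hp) u)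
  refine (abs_add_le _ _).trans ((add_le_add h1 (h3.trans h2)).trans (le_of_eq ?_))
  ring

/-- For q ≥ 2 a unit has nonzero `val`; for q = 1 the two sides would be 1 and 0. -/
theorem leastPosResidue_coe_unit {q : ℕ} [NeZero q] (hq : 2 ≤ q) (u : (ZMod q)ˣ) :
    leastPosResidue (u : ZMod q) = (u : ZMod q).val := by
  have hr0 : 0 < (u : ZMod q).val := by
    have h := ZMod.val_coe_unit_coprime u
    refine Nat.pos_of_ne_zero fun h0 => ?_
    rw [h0, Nat.coprime_zero_left] at h
    omega
  refine le_antisymm (Nat.sInf_le ⟨hr0, ZMod.natCast_zmod_val _⟩)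
    (le_csInf ⟨_, hr0, ZMod.natCast_zmod_val _⟩ ?_)
  rintro r ⟨-, hr⟩
  rw [← hr, ZMod.val_natCast]
  exact Nat.mod_le _ _

/-! ### Summing over characters and the final estimate -/

theorem primitiveCharacter_ne_one {q : ℕ} [NeZero q] {χ : DirichletCharacter ℂ q} (hχ : χ ≠ 1) :
    χ.primitiveCharacter ≠ 1 := fun h => hχ <| by
  rw [← χ.changeLevel_primitiveCharacter, h, map_one]

theorem sum_normSq_mul_tsum_eq {q : ℕ} [NeZero q] (K : ℕ) (a b : (ZMod q)ˣ) :
    ∑ χ : DirichletCharacter ℂ q, ((‖χ (a : ZMod q) - χ (b : ZMod q)‖ ^ 2 : ℝ) : ℂ) *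
        ∑' n : ℕ, χ.primitiveCharacter n * (smoothMangoldt K n : ℂ)
      = ((q.totient * (2 * ∑' n, classTerm K (1 : (ZMod q)ˣ) n - ∑' n, classTerm K (a * b⁻¹) n
        - ∑' n, classTerm K (b * a⁻¹) n) : ℝ) : ℂ) := by
  have hs : ∀ χ : DirichletCharacter ℂ q,
      Summable fun n : ℕ => χ.primitiveCharacter n * (smoothMangoldt K n : ℂ) := fun χ =>
    summable_twist_poissonWeight χ.primitiveCharacter K
  simp_rw [← tsum_mul_left]
  rw [← Summable.tsum_finsetSum fun χ _ => (hs χ).mul_left _]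
  rw [← ((summable_classTerm K _).mul_left 2).tsum_sub
    (summable_classTerm K _), ← (((summable_classTerm K _).mul_left 2).sub
      (summable_classTerm K _)).tsum_sub (summable_classTerm K _), ← tsum_mul_left,
    Complex.ofReal_tsum]
  refine tsum_congr fun n => ?_
  have h1 := smoothMangoldt_mul_sum_char K (1 : (ZMod q)ˣ) n
  have h2 := smoothMangoldt_mul_sum_char K (a * b⁻¹) n
  have h3 := smoothMangoldt_mul_sum_char K (b * a⁻¹) n
  push_cast
  have h4 : (q.totient : ℂ) * (2 * (classTerm K (1 : (ZMod q)ˣ) n : ℂ) - (classTerm K (a * b⁻¹) n : ℂ)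
      - (classTerm K (b * a⁻¹) n : ℂ)) = 2 * (q.totient * (classTerm K (1 : (ZMod q)ˣ) n : ℂ))
      - q.totient * (classTerm K (a * b⁻¹) n : ℂ) - q.totient * (classTerm K (b * a⁻¹) n : ℂ) := by
    ring
  rw [h4, ← h1, ← h2, ← h3]
  simp only [Finset.mul_sum, ← Finset.sum_sub_distrib]
  refine Finset.sum_congr rfl fun χ _ => ?_
  have h5 := norm_sub_sq_dirichletCharacter χ a b
  rw [Complex.ofReal_pow] at h5
  rw [h5]
  ring

theorem norm_Mstar_add_sum_le {C : ℝ} {K : ℕ} (hC0 : 0 < C)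
    (hC : ∀ (N : ℕ) [NeZero N] (χ : DirichletCharacter ℂ N), χ ≠ 1 →
      ‖deriv χ.LFunction 1 / χ.LFunction 1 + ∑' n : ℕ, χ n *
        ((vonMangoldt n / n * poissonWeight K n : ℝ) : ℂ)‖ ≤ C * Real.log N * (4 / 5) ^ K)
    {q : ℕ} [NeZero q] (a b : (ZMod q)ˣ) :
    ‖Mstar q a b + ∑ χ : DirichletCharacter ℂ q,
        ((‖χ (a : ZMod q) - χ (b : ZMod q)‖ ^ 2 : ℝ) : ℂ) *
        ∑' n : ℕ, χ.primitiveCharacter n * (smoothMangoldt K n : ℂ)‖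
      ≤ q.totient * (4 * (C * Real.log q * (4 / 5) ^ K)) := by
  classical
  -- The principal character has |χ(a) - χ(b)| = 0, so it can be included for orthogonality.
  have hD : ∑ χ : DirichletCharacter ℂ q with χ ≠ 1,
        ((‖χ (a : ZMod q) - χ (b : ZMod q)‖ ^ 2 : ℝ) : ℂ) *
        ∑' n : ℕ, χ.primitiveCharacter n * (smoothMangoldt K n : ℂ)
      = ∑ χ : DirichletCharacter ℂ q, ((‖χ (a : ZMod q) - χ (b : ZMod q)‖ ^ 2 : ℝ) : ℂ) *
        ∑' n : ℕ, χ.primitiveCharacter n * (smoothMangoldt K n : ℂ) := by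
    refine Finset.sum_filter_of_ne fun χ _ h h1 => h ?_
    rw [h1, MulChar.one_apply_coe, MulChar.one_apply_coe]
    simp
  have hM : Mstar q a b = ∑ χ : DirichletCharacter ℂ q with χ ≠ 1,
      ((‖χ (a : ZMod q) - χ (b : ZMod q)‖ ^ 2 : ℝ) : ℂ) * logDerivLStarOne χ := by
    unfold Mstar
    congr!
  have hq0 : (0 : ℝ) < q := by exact_mod_cast NeZero.pos q
  have hlog : 0 ≤ Real.log q := Real.log_natCast_nonneg q
  rw [← hD, hM, ← Finset.sum_add_distrib]
  have hterm : ∀ χ ∈ Finset.univ.filter (fun χ : DirichletCharacter ℂ q => χ ≠ 1),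
      ‖((‖χ (a : ZMod q) - χ (b : ZMod q)‖ ^ 2 : ℝ) : ℂ) * logDerivLStarOne χ +
        ((‖χ (a : ZMod q) - χ (b : ZMod q)‖ ^ 2 : ℝ) : ℂ) *
        ∑' n : ℕ, χ.primitiveCharacter n * (smoothMangoldt K n : ℂ)‖
      ≤ 4 * (C * Real.log q * (4 / 5) ^ K) := fun χ hχ => by
    have : NeZero χ.conductor := ⟨χ.conductor_ne_zero⟩
    have h1 := hC χ.conductor χ.primitiveCharacter
      (primitiveCharacter_ne_one (Finset.mem_filter.1 hχ).2)
    rw [← mul_add, norm_mul, Complex.norm_real, Real.norm_of_nonneg (by positivity)]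
    refine mul_le_mul (norm_sub_sq_le_four χ a b) (h1.trans ?_) (norm_nonneg _) (by norm_num)
    have h2 : Real.log χ.conductor ≤ Real.log q := by
      refine Real.log_le_log (by exact_mod_cast NeZero.pos χ.conductor) ?_
      exact_mod_cast Nat.le_of_dvd (NeZero.pos q) χ.conductor_dvd_level
    gcongr
  refine (norm_sum_le_of_le _ hterm).trans ?_
  rw [Finset.sum_const, nsmul_eq_mul]
  refine mul_le_mul_of_nonneg_right ?_ (by positivity)
  have hcard : Fintype.card (DirichletCharacter ℂ q) = q.totient := by
    rw [← Nat.card_eq_fintype_card, DirichletCharacter.card_eq_totient_of_hasEnoughRootsOfUnity]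
  rw [← hcard]
  exact_mod_cast Finset.card_le_univ _

theorem three_le_of_units_ne {q : ℕ} [NeZero q] {a b : (ZMod q)ˣ} (hab : a ≠ b) : 3 ≤ q := by
  by_contra h
  have h0 := NeZero.ne q
  have hq : q = 1 ∨ q = 2 := by omega
  rcases hq with rfl | rfl
  · exact hab (Subsingleton.elim a b)
  · exact hab (Subsingleton.elim a b)

/-- The 5 comes from log x ≤ x - 1 ≤ -1/5. -/
theorem pow_le_inv_of_five_mul_log_le {q K : ℕ} (hq : 0 < q) (hK : 5 * Real.log q ≤ K) {x : ℝ}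
    (hx0 : 0 < x) (hx : x ≤ 4 / 5) : x ^ K ≤ (q : ℝ)⁻¹ := by
  have hq0 : (0 : ℝ) < q := by exact_mod_cast hq
  have h1 := Real.log_le_sub_one_of_pos hx0
  rw [← Real.log_le_log_iff (by positivity) (by positivity), Real.log_pow, Real.log_inv]
  nlinarith [Nat.cast_nonneg (α := ℝ) K]

theorem mainTheorem3 (hGRH : GRH) :
    ∃ C : ℝ, ∀ (q : ℕ) [NeZero q] (a b : (ZMod q)ˣ), a ≠ b →
      ∀ r₁ r₂ : ℕ,
        r₁ = leastPosResidue ((a * b⁻¹ : (ZMod q)ˣ) : ZMod q) →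
        r₂ = leastPosResidue ((b * a⁻¹ : (ZMod q)ˣ) : ZMod q) →
        ‖Mstar q a b - (((Nat.totient q : ℝ) *
            (ArithmeticFunction.vonMangoldt r₁ / (r₁ : ℝ) +
              ArithmeticFunction.vonMangoldt r₂ / (r₂ : ℝ) + HSum q a b) : ℝ) : ℂ)‖
          ≤ C * ((Nat.totient q : ℝ) * (Real.log q ^ 2 / (q : ℝ))) := by
  obtain ⟨C, hC0, hC⟩ := exists_norm_logDeriv_LFunction_one_add_tsum_le hGRH
  -- 4C comes from truncation, as |χ(a) - χ(b)|² ≤ 4. Four class errors of 628 (the class of 1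
  -- counted twice) and 2 · 2 for the h-terms of that class make 2516.
  refine ⟨4 * C + 2516, fun q _ a b hab r₁ r₂ hr₁ hr₂ => ?_⟩
  have hq3 := three_le_of_units_ne hab
  have hq2 : 2 ≤ q := by omega
  have hq0 : (0 : ℝ) < q := by positivity
  have hℓ := one_lt_log_of_three_le hq3
  set ℓ := Real.log q with hℓdef
  set K := ⌈5 * ℓ⌉₊ with hKdef
  have hKlo : 5 * ℓ ≤ K := Nat.le_ceil _
  have hKhi : (K : ℝ) ≤ 6 * ℓ := by
    have := Nat.ceil_lt_add_one (by positivity : 0 ≤ 5 * ℓ)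
    linarith
  have hK2 : 2 ≤ K := by
    have : (2 : ℝ) ≤ K := by linarith
    exact_mod_cast this
  have h2K : (2 : ℝ)⁻¹ ^ K ≤ (q : ℝ)⁻¹ :=
    pow_le_inv_of_five_mul_log_le (by omega) hKlo (by norm_num) (by norm_num)
  have h45 : (4 / 5 : ℝ) ^ K ≤ (q : ℝ)⁻¹ :=
    pow_le_inv_of_five_mul_log_le (by omega) hKlo (by norm_num) le_rfl
  have hM := norm_Mstar_add_sum_le (K := K) hC0 (fun N _ χ hχ => hC N χ hχ K) a b
  rw [sum_normSq_mul_tsum_eq] at hM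
  -- With K ≤ 6ℓ and ℓ > 1: 4 + 8 · 6 + 16 · 36 = 628.
  have herr : (4 * ℓ + 8 * K * (1 + 2 * K)) / q ≤ 628 * (ℓ ^ 2 / q) := by
    rw [← mul_div_assoc]
    gcongr
    nlinarith [mul_le_mul hKhi hKhi (Nat.cast_nonneg K) (by positivity : 0 ≤ 6 * ℓ)]
  have h1 := (abs_tsum_classTerm_sub_le hq2 hK2 h2K (1 : (ZMod q)ˣ)).trans herr
  have h2 := (abs_tsum_classTerm_sub_le hq2 hK2 h2K (a * b⁻¹)).trans herr
  have h3 := (abs_tsum_classTerm_sub_le hq2 hK2 h2K (b * a⁻¹)).trans herr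
  rw [leastPosResidue_coe_unit hq2] at hr₁ hr₂
  rw [← hr₁] at h2
  rw [← hr₂] at h3
  -- The class of u produces h at u⁻¹, so the two h-sums trade places; H is symmetric in them.
  have hinv₁ : (a * b⁻¹)⁻¹ = b * a⁻¹ := by rw [mul_inv, inv_inv, mul_comm]
  have hinv₂ : (b * a⁻¹)⁻¹ = a * b⁻¹ := by rw [mul_inv, inv_inv, mul_comm]
  rw [hinv₁] at h2
  rw [hinv₂] at h3
  have : Fact (1 < q) := ⟨hq2⟩
  rw [Units.val_one, ZMod.val_one, vonMangoldt_apply_one, zero_div, zero_add, inv_one] at h1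
  have hH : HSum q a b = ∑ p ∈ q.primeFactors, hTerm q p (a * b⁻¹)
      + ∑ p ∈ q.primeFactors, hTerm q p (b * a⁻¹) := Finset.sum_add_distrib
  have hone : ∀ p ∈ q.primeFactors, 0 ≤ hTerm q p 1 ∧ hTerm q p 1 ≤ 2 * Real.log p / q :=
    fun p hp => hTerm_one_le hq2 (Nat.prime_of_mem_primeFactors hp) (Nat.dvd_of_mem_primeFactors hp)
  have hone0 : 0 ≤ ∑ p ∈ q.primeFactors, hTerm q p 1 := Finset.sum_nonneg fun p hp => (hone p hp).1
  have hone1 : ∑ p ∈ q.primeFactors, hTerm q p 1 ≤ 2 * (ℓ ^ 2 / q) := by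
    refine (Finset.sum_le_sum fun p hp => (hone p hp).2).trans ?_
    rw [← Finset.sum_div, ← Finset.mul_sum, ← mul_div_assoc]
    have := sum_log_primeFactors_le (NeZero.ne q)
    gcongr
    nlinarith
  set S₀ := ∑' n, classTerm K (1 : (ZMod q)ˣ) n
  set S₁ := ∑' n, classTerm K (a * b⁻¹) n
  set S₂ := ∑' n, classTerm K (b * a⁻¹) n
  set E := ℓ ^ 2 / (q : ℝ) with hE
  have hE0 : 0 ≤ E := by positivity
  set T := vonMangoldt r₁ / (r₁ : ℝ) + vonMangoldt r₂ / (r₂ : ℝ) + HSum q a b with hT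
  have hreal : |2 * S₀ - S₁ - S₂ + T| ≤ 2516 * E := by
    rw [abs_le] at h1 h2 h3 ⊢
    rw [hT, hH]
    constructor <;> linarith
  have hfirst : 4 * (C * ℓ * (4 / 5) ^ K) ≤ 4 * C * E := by
    have : ℓ * (4 / 5) ^ K ≤ E := by
      rw [hE, div_eq_mul_inv]
      refine mul_le_mul (by nlinarith) h45 (by positivity) (by positivity)
    nlinarith
  have hφ : (0 : ℝ) ≤ q.totient := Nat.cast_nonneg _
  have hsplit : Mstar q a b - ((q.totient * T : ℝ) : ℂ)
      = (Mstar q a b + ((q.totient * (2 * S₀ - S₁ - S₂) : ℝ) : ℂ))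
        - ((q.totient * (2 * S₀ - S₁ - S₂ + T) : ℝ) : ℂ) := by
    push_cast
    ring
  rw [hsplit]
  calc _ ≤ q.totient * (4 * (C * ℓ * (4 / 5) ^ K)) + q.totient * (2516 * E) := by
        refine (norm_sub_le _ _).trans (add_le_add hM ?_)
        rw [Complex.norm_real, Real.norm_eq_abs, abs_mul, abs_of_nonneg hφ]
        exact mul_le_mul_of_nonneg_left hreal hφ
    _ ≤ q.totient * (4 * C * E) + q.totient * (2516 * E) := by gcongr
    _ = _ := by ring
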